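/- **Setting.** Let $L\subset S^3$ be an oriented link given by an oriented diagram on the 2-sphere whose underlying 4-valent graph is connected and non-empty, such that every component of $L$ over-passes at some crossing and under-passes at some crossing. Let $h$ be the number of components and $n$ the number of regions. Assign a variable $w_r$ to each region and a variable $m_i$ to each component. Draw a crossing with both strands pointing upwards; let $\alpha$ (from bottom right to top left) and $\beta$ (from bottom left to top right) denote the strands and also the components containing them, and let $w_j,w_k,w_l,w_m$ be the variables of the top, left, bottom and right corner. If the crossing is positive ($\beta$ passes over $\alpha$) put $$\mathbb W_c=\mathrm{Li}_2\Big(\tfrac{w_m}{m_\beta w_j}\Big)+\mathrm{Li}_2\Big(\tfrac{w_k}{m_\alpha w_j}\Big)-\mathrm{Li}_2\Big(\tfrac{w_l}{m_\beta w_k}\Big)-\mathrm{Li}_2\Big(\tfrac{w_l}{m_\alpha w_m}\Big)+\mathrm{Li}_2\Big(\tfrac{w_jw_l}{w_mw_k}\Big)-\tfrac{\pi^2}{6}+\log\tfrac{w_m}{m_\beta w_j}\,\log\tfrac{w_k}{m_\alpha w_j};$$ if it is negative ($\alpha$ passes over $\beta$) put $$\mathbb W_c=-\mathrm{Li}_2\Big(\tfrac{m_\beta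 w_m}{w_j}\Big)-\mathrm{Li}_2\Big(\tfrac{m_\alpha w_k}{w_j}\Big)+\mathrm{Li}_2\Big(\tfrac{m_\beta w_l}{w_k}\Big)+\mathrm{Li}_2\Big(\tfrac{m_\alpha w_l}{w_m}\Big)-\mathrm{Li}_2\Big(\tfrac{w_jw_l}{w_mw_k}\Big)+\tfrac{\pi^2}{6}-\log\tfrac{m_\beta w_m}{w_j}\,\log\tfrac{m_\alpha w_k}{w_j}.$$ Let $\mathbb W=\sum_c\mathbb W_c$. The numbers $\exp(w_r\,\partial\mathbb W/\partial w_r)$ do not depend on the local branches chosen for $\log$ and for $\mathrm{Li}_2(z)=-\int_0^z\frac{\log(1-t)}{t}\,dt$. A point $(\mathbf w,\mathbf m)\in(\mathbb C^\times)^{n+h}$ is *non-degenerate* if at no crossing any of the five arguments of $\mathrm{Li}_2$ equals $1$. The complement of $L$ and two points $p$ (above the diagram) and $q$ (below it) is decomposed into ideal octahedra, one between the two strands at each crossing $c$: the top vertex lies on the over-strand, the bottom vertex on the under-strand; there is one equatorial vertex in the direction of each half-strand, those over the under-strand being pulled to $p$ and those under the over-strand being pulled to $q$, so that the equatorial edges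 run through the four corners of $c$. Along each edge of the diagram, and on each side of it, the octahedra at the two ends of that edge are glued along one face. Adding the diagonals $pp$ and $qq$ divides each octahedron into five tetrahedra: two at the top vertex, containing the diagonal $pp$; two at the bottom vertex, containing $qq$; and a central one. This is the ideal triangulation $\mathcal T$. For a tetrahedron with vertices $z_0,\dots,z_3$ put $[z_0:z_1:z_2:z_3]=\frac{(z_0-z_3)(z_1-z_2)}{(z_0-z_2)(z_1-z_3)}=z$; the cross-ratio is $z$ at the edges $01,23$, it is $\frac1{1-z}$ at $03,12$ and $1-\frac1z$ at $02,13$. Write $o^\pm,u^\pm$ for the equatorial vertices at the outgoing ($+$) and incoming ($-$) halves of the over- and the under-strand, and $T,B$ for the top and the bottom vertex. At a positive crossing assign $$[T:o^+:u^-:u^+]=\tfrac{w_m}{m_\beta w_j},\ [T:o^-:u^+:u^-]=\tfrac{m_\beta w_k}{w_l},\ [B:u^+:o^-:o^+]=\tfrac{w_k}{m_\alpha w_j},\ [B:u^-:o^+:o^-]=\tfrac{m_\alpha w_m}{w_l},\ [o^+:o^-:u^-:u^+]=\tfrac{w_jw_l}{w_mw_k},$$ and at a negative crossing $$[T:o^+:u^+:u^-]=\tfrac{w_j}{m_\alpha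 w_k},\ [T:o^-:u^-:u^+]=\tfrac{m_\alpha w_l}{w_m},\ [B:u^+:o^+:o^-]=\tfrac{w_j}{m_\beta w_m},\ [B:u^-:o^-:o^+]=\tfrac{m_\beta w_l}{w_k},\ [o^+:o^-:u^+:u^-]=\tfrac{w_kw_m}{w_jw_l}.$$ **Theorem.** Let $(\mathbf w,\mathbf m)\in(\mathbb C^\times)^{n+h}$ be a non-degenerate point with $\exp\big(w_r\,\frac{\partial\mathbb W}{\partial w_r}\big)=1$ for every region $r$. Then all assigned cross-ratios lie in $\mathbb C\setminus\{0,1\}$, and the gluing equations of $\mathcal T$ hold: the product of the cross-ratios around every edge of $\mathcal T$ is $1$. There is a representation $\rho_{\mathbf w,\mathbf m}:\pi_1(S^3\setminus L)\to\mathrm{PSL}(2,\mathbb C)$, unique up to conjugation, which is a holonomy representation of $\mathcal T$ with these cross-ratios; that is, there is a $\rho_{\mathbf w,\mathbf m}$-equivariant map from the ideal vertices of the universal cover of $\mathcal T$ to $\mathbb C\cup\{\infty\}$ which sends the vertices of each tetrahedron to four distinct points with the assigned cross-ratio. For every component $i$ and every meridian $\mu_i$ of it, the eigenvalues of $\rho_{\mathbf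 w,\mathbf m}(\mu_i)$ are $m_i$ and $m_i^{-1}$ up to a common sign. Here $\pi_1(S^3\setminus L)$ is taken in its Wirtinger presentation, and the meridians are the conjugates of the Wirtinger generators and of their inverses. -/

import Mathlib

open scoped LinearAlgebra.Projectivization Topology

noncomputable section

namespace LinkPotential

/-! ## Oriented link diagrams

At every crossing the two strands are drawn pointing upwards.  The strand `beta` runs from the
bottom left to the top right, the strand `alpha` from the bottom right to the top left.  The
crossing is positive if `beta` is the over-strand and negative if `alpha` is the over-strand.
The four corners of a crossing are `j` (top), `k` (left), `l` (bottom), `m` (right). -/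

/-- The two strands at a crossing. -/
inductive Strand
  | alpha
  | beta
  deriving DecidableEq

instance : Fintype Strand := ⟨{.alpha, .beta}, fun s => by cases s <;> simp⟩

/-- The outgoing and the incoming half of a strand at a crossing. -/
inductive Half
  | out
  | inc
  deriving DecidableEq

/-- The two sides of an oriented strand. -/
inductive Side
  | left
  | right
  deriving DecidableEq

/-- The four corners (quadrants) at a crossing. -/
inductive Corner
  | j
  | k
  | l
  | m
  deriving DecidableEq

/-- The other strand at the same crossing. -/
def Strand.other : Strand → Strand
  | .alpha => .beta
  | .beta => .alpha

/-- The corner of a crossing which lies on the given side of the given half-strand. -/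
def cornerAt : Strand → Half → Side → Corner
  | .beta, .out, .left => .j
  | .beta, .out, .right => .m
  | .alpha, .out, .left => .k
  | .alpha, .out, .right => .j
  | .beta, .inc, .left => .k
  | .beta, .inc, .right => .l
  | .alpha, .inc, .left => .l
  | .alpha, .inc, .right => .m

/-- `cornerAt s e d` is bounded by the half-strand `(s, e)` and by one half of the other strand;
this is that half of the other strand. -/
def otherHalf : Strand → Half → Side → Half
  | .beta, .out, .left => .out
  | .beta, .out, .right => .inc
  | .alpha, .out, .left => .inc
  | .alpha, .out, .right => .out
  | .beta, .inc, .left => .out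
  | .beta, .inc, .right => .inc
  | .alpha, .inc, .left => .inc
  | .alpha, .inc, .right => .out

/-- An oriented 4-valent combinatorial map with over/under information.  `next (c, s) = (c', s')`
means that the strand `s` leaving the crossing `c` next arrives at the crossing `c'`, where it is
the strand `s'`.  Hence the pairs `(c, s)` are also the edges of the underlying graph, an edge
being named after the half-strand out of which it runs. -/
structure OrientedDiagram where
  Crossing : Type
  [fintypeCrossing : Fintype Crossing]
  positive : Crossing → Bool
  next : Equiv.Perm (Crossing × Strand)

attribute [instance] OrientedDiagram.fintypeCrossing

namespace OrientedDiagram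

variable (D : OrientedDiagram)

/-- The edges of the underlying 4-valent graph. -/
abbrev Edge : Type := D.Crossing × Strand

/-- The over-strand at a crossing. -/
def overStrand (c : D.Crossing) : Strand := if D.positive c then .beta else .alpha

/-- The under-strand at a crossing. -/
def underStrand (c : D.Crossing) : Strand := (D.overStrand c).other

/-- The edge which arrives at `c` along the strand `s`. -/
def inEdge (c : D.Crossing) (s : Strand) : D.Edge := D.next.symm (c, s)

/-- Two corners are consecutive corners of the same region when they are the corners at the two
ends of an edge, on the same side of that edge. -/
inductive CornerAdj : D.Crossing × Corner → D.Crossing × Corner → Prop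
  | along (e : D.Edge) (d : Side) :
      CornerAdj (e.1, cornerAt e.2 .out d) ((D.next e).1, cornerAt (D.next e).2 .inc d)

/-- The regions of the diagram (the faces of the combinatorial map): corners modulo the equivalence
relation generated by `CornerAdj`. -/
def Region : Type := Quot D.CornerAdj

/-- The region at a given corner. -/
def region (c : D.Crossing) (q : Corner) : D.Region := Quot.mk _ (c, q)

/-- The components of the link: edges modulo continuing straight through the crossings. -/
def Component : Type := Quot (fun e e' : D.Edge => D.next e = e')

/-- The component which contains a given edge. -/
def component (e : D.Edge) : D.Component := Quot.mk _ e

/-- The underlying graph is connected and non-empty. -/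
def IsConnected : Prop :=
  Nonempty D.Crossing ∧
    ∀ c c' : D.Crossing, Relation.EqvGen (fun a b => ∃ s s', D.next (a, s) = (b, s')) c c'

/-- The combinatorial map has the Euler characteristic of the sphere.  For a connected map this
says that it is drawn on the 2-sphere. -/
def IsSpherical : Prop :=
  Nat.card D.Crossing + Nat.card D.Region = Nat.card D.Edge + 2

/-- Every component over-passes at some crossing and under-passes at some crossing. -/
def HasOverUnder : Prop :=
  ∀ i : D.Component,
    (∃ c, D.component (c, D.overStrand c) = i) ∧ (∃ c, D.component (c, D.underStrand c) = i)

/-! ## The link group and its meridians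

The link group `π₁(S³ ∖ L)` is given by the Wirtinger presentation of the diagram.  The base point
is above the plane of the diagram; the generator of an edge is the loop which goes down to the right
of the edge, passes below the edge and comes up to the left of it.  Products of loops are read from
left to right. -/

/-- The Wirtinger relators: the two edges of the over-strand at a crossing have the same generator,
and the generators of the two edges of the under-strand are conjugate by it. -/
inductive WirtingerRel : FreeGroup D.Edge → Prop
  | over (c : D.Crossing) :
      WirtingerRel (FreeGroup.of (D.inEdge c (D.overStrand c)) *
        (FreeGroup.of (c, D.overStrand c))⁻¹)
  | underPositive (c : D.Crossing) (hc : D.positive c = true) :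
      WirtingerRel
        ((FreeGroup.of (c, D.overStrand c))⁻¹ * FreeGroup.of (D.inEdge c (D.underStrand c)) *
          FreeGroup.of (c, D.overStrand c) * (FreeGroup.of (c, D.underStrand c))⁻¹)
  | underNegative (c : D.Crossing) (hc : D.positive c = false) :
      WirtingerRel
        (FreeGroup.of (c, D.overStrand c) * FreeGroup.of (D.inEdge c (D.underStrand c)) *
          (FreeGroup.of (c, D.overStrand c))⁻¹ * (FreeGroup.of (c, D.underStrand c))⁻¹)

/-- The group of the link. -/
abbrev LinkGroup : Type := PresentedGroup {r | D.WirtingerRel r}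

/-- The Wirtinger generator of an edge. -/
def wirtinger (e : D.Edge) : D.LinkGroup := PresentedGroup.of e

/-- `g` is a meridian of the component `i` (with either orientation and any path to the base
point). -/
def IsMeridian (i : D.Component) (g : D.LinkGroup) : Prop :=
  ∃ (e : D.Edge) (h : D.LinkGroup), D.component e = i ∧
    (g = h * D.wirtinger e * h⁻¹ ∨ g = h * (D.wirtinger e)⁻¹ * h⁻¹)

end OrientedDiagram

/-! ## The generalized potential function -/

/-- `ℓ` is a branch of the logarithm near `x`. -/
def IsLogBranchAt (ℓ : ℂ → ℂ) (x : ℂ) : Prop :=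
  AnalyticAt ℂ ℓ x ∧ ∀ᶠ z in 𝓝 x, Complex.exp (ℓ z) = z

/-- `F` is a branch of the dilogarithm `Li₂(z) = -∫₀ᶻ log (1 - t) / t dt` near `x`: on a connected
open set containing `0` and `x` it is the holomorphic function with `F 0 = 0` and
`F' z = - log (1 - z) / z`, for a branch of `log (1 - z)` (the value of that branch at `0` is then
`0`).  The principal branch is the one on the plane cut along `[1, ∞)`. -/
def IsDilogBranchAt (F : ℂ → ℂ) (x : ℂ) : Prop :=
  ∃ U : Set ℂ, IsOpen U ∧ IsConnected U ∧ 0 ∈ U ∧ x ∈ U ∧ DifferentiableOn ℂ F U ∧ F 0 = 0 ∧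
    ∀ z ∈ U, Complex.exp (-(z * deriv F z)) = 1 - z

/-- Functions used as the dilogarithms and logarithms in the terms of the potential function of one
crossing. -/
structure Branches where
  dilog : Fin 5 → ℂ → ℂ
  log : Fin 2 → ℂ → ℂ

namespace OrientedDiagram

variable (D : OrientedDiagram)

/-- The arguments of the five dilogarithms at a crossing. -/
def dilogArg (w : D.Region → ℂ) (m : D.Component → ℂ) (c : D.Crossing) : Fin 5 → ℂ :=
  let wj := w (D.region c .j)
  let wk := w (D.region c .k)
  let wl := w (D.region c .l)
  let wm := w (D.region c .m)
  let ma := m (D.component (c, .alpha))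
  let mb := m (D.component (c, .beta))
  if D.positive c then
    ![wm / (mb * wj), wk / (ma * wj), wl / (mb * wk), wl / (ma * wm), wj * wl / (wm * wk)]
  else
    ![mb * wm / wj, ma * wk / wj, mb * wl / wk, ma * wl / wm, wj * wl / (wm * wk)]

/-- The arguments of the two logarithms at a crossing. -/
def logArg (w : D.Region → ℂ) (m : D.Component → ℂ) (c : D.Crossing) : Fin 2 → ℂ :=
  ![D.dilogArg w m c 0, D.dilogArg w m c 1]

/-- The contribution of a crossing to the generalized potential function. -/
def crossingPotential (B : Branches) (w : D.Region → ℂ) (m : D.Component → ℂ)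
    (c : D.Crossing) : ℂ :=
  let x := D.dilogArg w m c
  let y := D.logArg w m c
  (if D.positive c then 1 else -1) *
    (B.dilog 0 (x 0) + B.dilog 1 (x 1) - B.dilog 2 (x 2) - B.dilog 3 (x 3) + B.dilog 4 (x 4)
      - (Real.pi : ℂ) ^ 2 / 6 + B.log 0 (y 0) * B.log 1 (y 1))

/-- The generalized potential function. -/
def potential (B : D.Crossing → Branches) (w : D.Region → ℂ) (m : D.Component → ℂ) : ℂ :=
  ∑ c, D.crossingPotential (B c) w m c

/-- All the functions in `B` are branches of the dilogarithm and of the logarithm near the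
arguments at which they are evaluated at the point `(w, m)`. -/
def AreBranchesAt (B : D.Crossing → Branches) (w : D.Region → ℂ) (m : D.Component → ℂ) : Prop :=
  ∀ c, (∀ i, IsDilogBranchAt ((B c).dilog i) (D.dilogArg w m c i)) ∧
    (∀ i, IsLogBranchAt ((B c).log i) (D.logArg w m c i))

open Classical in
/-- The partial derivative of the potential function with respect to the variable of the region
`r`. -/
def potentialDeriv (B : D.Crossing → Branches) (w : D.Region → ℂ) (m : D.Component → ℂ)
    (r : D.Region) : ℂ :=
  deriv (fun t : ℂ => D.potential B (Function.update w r t) m) (w r)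

/-- `exp (w_r ∂W/∂w_r) = 1` for every region `r`, where `W` is formed with some branches of its
multivalued terms near the point. -/
def IsSolution (w : D.Region → ℂ) (m : D.Component → ℂ) : Prop :=
  ∃ B : D.Crossing → Branches, D.AreBranchesAt B w m ∧
    ∀ r, Complex.exp (w r * D.potentialDeriv B w m r) = 1

/-- None of the five values at any crossing is `1`. -/
def IsNondegenerate (w : D.Region → ℂ) (m : D.Component → ℂ) : Prop :=
  ∀ c i, D.dilogArg w m c i ≠ 1

end OrientedDiagram

/-! ## The ideal triangulation

An ideal octahedron is placed at every crossing between the two strands.  Its top vertex lies on the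
over-strand, its bottom vertex on the under-strand, and it has an equatorial vertex in the direction
of each of the four half-strands.  The two equatorial vertices above the under-strand are pulled up
to the point `p`, the two equatorial vertices below the over-strand are pulled down to the point
`q`.  The four equatorial edges, one in each corner, become regional edges from `p` to `q`. -/

/-- The vertices of the octahedron at a crossing. -/
inductive OctVertex
  | top
  | bottom
  | equator (s : Strand) (e : Half)
  deriving DecidableEq

/-- The cross-ratio at the edge joining the vertices `a < b` of an ideal tetrahedron whose
cross-ratio `[z₀ : z₁ : z₂ : z₃]` is `z`. -/
def edgeCrossRatio (z : ℂ) : Fin 4 → Fin 4 → ℂ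
  | 0, 1 => z
  | 2, 3 => z
  | 0, 3 => 1 / (1 - z)
  | 1, 2 => 1 / (1 - z)
  | 0, 2 => 1 - 1 / z
  | 1, 3 => 1 - 1 / z
  | _, _ => 1

/-- The cross-ratio `(z₀ - z₃) (z₁ - z₂) / ((z₀ - z₂) (z₁ - z₃))` of four points of the projective
line `ℂ ∪ {∞}`, written in homogeneous coordinates. -/
def crossRatio (z : Fin 4 → ℙ ℂ (Fin 2 → ℂ)) : ℂ :=
  let d : Fin 4 → Fin 4 → ℂ := fun a b => Matrix.det ![(z a).rep, (z b).rep]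
  d 0 3 * d 1 2 / (d 0 2 * d 1 3)

namespace OrientedDiagram

variable (D : OrientedDiagram)

/-- The ordered vertices of the five tetrahedra into which the octahedron at a crossing is divided
by the diagonal joining the two vertices at `p` and the diagonal joining the two vertices at `q`:
two tetrahedra at the top vertex, two at the bottom vertex, and the central one. -/
def tetVertex (c : D.Crossing) (t : Fin 5) : Fin 4 → OctVertex :=
  let o := D.overStrand c
  let u := D.underStrand c
  let oOut := OctVertex.equator o .out
  let oInc := OctVertex.equator o .inc
  let uOut := OctVertex.equator u .out
  let uInc := OctVertex.equator u .inc
  if D.positive c then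
    (![![.top, oOut, uInc, uOut], ![.top, oInc, uOut, uInc],
       ![.bottom, uOut, oInc, oOut], ![.bottom, uInc, oOut, oInc],
       ![oOut, oInc, uInc, uOut]] : Fin 5 → Fin 4 → OctVertex) t
  else
    (![![.top, oOut, uOut, uInc], ![.top, oInc, uInc, uOut],
       ![.bottom, uOut, oOut, oInc], ![.bottom, uInc, oInc, oOut],
       ![oOut, oInc, uOut, uInc]] : Fin 5 → Fin 4 → OctVertex) t

/-- The cross-ratios assigned to the five tetrahedra at a crossing. -/
def shape (w : D.Region → ℂ) (m : D.Component → ℂ) (c : D.Crossing) : Fin 5 → ℂ :=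
  let wj := w (D.region c .j)
  let wk := w (D.region c .k)
  let wl := w (D.region c .l)
  let wm := w (D.region c .m)
  let ma := m (D.component (c, .alpha))
  let mb := m (D.component (c, .beta))
  if D.positive c then
    ![wm / (mb * wj), mb * wk / wl, wk / (ma * wj), ma * wm / wl, wj * wl / (wm * wk)]
  else
    ![wj / (ma * wk), ma * wl / wm, wj / (mb * wm), mb * wl / wk, wk * wm / (wj * wl)]

/-- The face of the octahedron at `c` which lies along the half-strand `(s, e)` on the side `d`.
Its vertices are listed in the order: the one on the link, the one at `p`, the one at `q`. -/
def faceVertex (c : D.Crossing) (s : Strand) (e : Half) (d : Side) : Fin 3 → OctVertex :=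
  if s = D.overStrand c then
    ![.top, .equator s.other (otherHalf s e d), .equator s e]
  else
    ![.bottom, .equator s e, .equator s.other (otherHalf s e d)]

/-- Along every edge of the diagram, and on either side of it, the octahedra at its two ends are
glued along their faces there, the vertices being matched in the order of `faceVertex`.  This is the
induced identification of the edges of the octahedra. -/
inductive EdgeGlue : D.Crossing × Sym2 OctVertex → D.Crossing × Sym2 OctVertex → Prop
  | glue (e : D.Edge) (d : Side) (a b : Fin 3) (hab : a ≠ b) :
      EdgeGlue
        (e.1, s(D.faceVertex e.1 e.2 .out d a, D.faceVertex e.1 e.2 .out d b))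
        ((D.next e).1, s(D.faceVertex (D.next e).1 (D.next e).2 .inc d a,
          D.faceVertex (D.next e).1 (D.next e).2 .inc d b))

/-- Edges of the ideal triangulation: pairs of vertices of an octahedron, up to gluing.  (A class of
pairs which are joined in none of the tetrahedra imposes no condition below.) -/
def IdealEdge : Type := Quot D.EdgeGlue

/-- The edge of the triangulation which joins the vertices `a` and `b` of a tetrahedron. -/
def idealEdge (c : D.Crossing) (t : Fin 5) (a b : Fin 4) : D.IdealEdge :=
  Quot.mk _ (c, s(D.tetVertex c t a, D.tetVertex c t b))

open Classical in
/-- The gluing equations: around every edge of the ideal triangulation the product of the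
cross-ratios is `1`. -/
def GluingEquations (w : D.Region → ℂ) (m : D.Component → ℂ) : Prop :=
  ∀ E : D.IdealEdge,
    ∏ x : D.Crossing × Fin 5 × Fin 4 × Fin 4 with
        x.2.2.1 < x.2.2.2 ∧ D.idealEdge x.1 x.2.1 x.2.2.1 x.2.2.2 = E,
      edgeCrossRatio (D.shape w m x.1 x.2.1) x.2.2.1 x.2.2.2 = 1

/-! ## The holonomy representation

A lift to the universal cover of the octahedron at `c` is given by a homotopy class of paths from
the base point to that octahedron.  The class of the path which goes down to the left of the
over-strand at `c`, and then horizontally to the octahedron, is the reference lift, and `(h, c)`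
stands for its translate by the element `h` of the link group. -/

/-- The path which goes down in the corner `q` of `c`, and then horizontally to the octahedron at
`c`, leads to the lift `(cornerShift c q, c)`. -/
def cornerShift (c : D.Crossing) (q : Corner) : D.LinkGroup :=
  if q = cornerAt (D.overStrand c) .out .left ∨ q = cornerAt (D.overStrand c) .inc .left then 1
  else D.wirtinger (c, D.overStrand c)

/-- `dev` is a (pseudo-)developing map with holonomy `ρ` of the ideal triangulation with the
cross-ratios given by `(w, m)`; here `dev h c v` is the image of the vertex `v` of the lift `(h, c)`
of the octahedron at `c`. -/
structure IsDeveloping (w : D.Region → ℂ) (m : D.Component → ℂ)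
    (ρ : D.LinkGroup →* Matrix.ProjectiveSpecialLinearGroup (Fin 2) ℂ)
    (dev : D.LinkGroup → D.Crossing → OctVertex → ℙ ℂ (Fin 2 → ℂ)) : Prop where
  /-- `dev` is equivariant. -/
  equivariant : ∀ g h c v, dev (g * h) c v = ρ g • dev h c v
  /-- `dev` agrees on the common faces of adjacent lifts: these are reached by going down in the
  region along the side `d` of the edge `e`. -/
  face : ∀ (h : D.LinkGroup) (e : D.Edge) (d : Side) (a : Fin 3),
    dev (h * D.cornerShift e.1 (cornerAt e.2 .out d)) e.1 (D.faceVertex e.1 e.2 .out d a) =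
      dev (h * D.cornerShift (D.next e).1 (cornerAt (D.next e).2 .inc d)) (D.next e).1
        (D.faceVertex (D.next e).1 (D.next e).2 .inc d a)
  /-- The image of a tetrahedron has distinct vertices. -/
  injective : ∀ h c t, Function.Injective fun a => dev h c (D.tetVertex c t a)
  /-- The image of a tetrahedron has the prescribed cross-ratio. -/
  crossRatio_eq : ∀ h c t, crossRatio (fun a => dev h c (D.tetVertex c t a)) = D.shape w m c t

/-- `ρ` is a holonomy representation of the ideal triangulation with the cross-ratios given by
`(w, m)`. -/
def IsHolonomy (w : D.Region → ℂ) (m : D.Component → ℂ)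
    (ρ : D.LinkGroup →* Matrix.ProjectiveSpecialLinearGroup (Fin 2) ℂ) : Prop :=
  ∃ dev, D.IsDeveloping w m ρ dev

end OrientedDiagram

end LinkPotential

end

namespace LinkPotential

/-! ## The projective line -/

/-! The point `p` is developed to ∞. The vertex at `q` below a region `r` is then a finite point
`pos r`, represented by the vector `w r • (pos r, 1)`, and next to each diagram edge `e` there is a
link vertex with vector `(V, 1)`. The Wirtinger generator of `e` becomes the matrix of determinant
one which has eigenvalue `m` at `(V, 1)` and carries the region vector on the left of `e` to the one
on the right. All this is encoded in a `Coloring`: a scale for each crossing (the lower left entry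
of the matrix of its over-strand), a scale for each edge (the determinant of its link vector and its
left region vector) and a position for each region.

A coloring exists by cohomology of the sphere. Since `exp (z Li₂'(z)) = 1 / (1 - z)`, the
exponentiated derivative of the potential at `r` is a product of rational factors over the corners
of `r`, whatever the branches. Each factor splits into contributions of half-strands; regrouped by
edges, the equation at `r` says that the multiplicative cochain `edgeRatio` is closed around `r`.
Hence it is exact, which gives the crossing scales. The increments of `pos` across edges form an
additive dual cochain whose closedness at a crossing is an identity of rational functions, so it is
exact as well. Exactness is a rank count with the Euler characteristic; the multiplicative version
needs an integral correction of logarithms (`exists_crossing_scale`).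

The Wirtinger relations hold because the two edges of an over-strand have the same matrix, and this
matrix carries the region vectors beside the left half of the under-strand to those beside the right
half. By Cayley–Hamilton a matrix of determinant one with given trace is determined by one vector
and an independent image of it, so the two under-matrices are conjugate (`conj_under`). The
developing map is read off from the same vectors: the face met by going down in `r` along `e` is
always the link vertex of `e`, ∞ and the vertex below `r`, so neighbouring octahedra agree
(`rep_shift_smul_octVec`). A meridian has trace `m i + (m i)⁻¹`, which gives its eigenvalues.

For uniqueness, two developing maps are made to agree on three vertices of one tetrahedron. Equal
cross-ratios propagate the agreement; that it reaches every lift uses that all components over-pass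
and under-pass (`IsHereditary.forall_of_tet`).

The gluing equations need no holonomy: regional edges give the corner products, the contributions to
an edge ending on the link cancel between the two ends of each diagram edge, and the diagonals have
product one within each octahedron. -/

/-- The determinant of two plane vectors. -/
def wedge (u v : Fin 2 → ℂ) : ℂ := u 0 * v 1 - u 1 * v 0

theorem det_pair (u v : Fin 2 → ℂ) : Matrix.det ![u, v] = wedge u v :=
  Matrix.det_fin_two _

theorem wedge_smul_left (a : ℂ) (u v : Fin 2 → ℂ) : wedge (a • u) v = a * wedge u v := by
  simp [wedge]; ring

theorem wedge_smul_right (a : ℂ) (u v : Fin 2 → ℂ) : wedge u (a • v) = a * wedge u v := by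
  simp [wedge]; ring

theorem wedge_mulVec (A : Matrix.SpecialLinearGroup (Fin 2) ℂ) (u v : Fin 2 → ℂ) :
    wedge (A.1.mulVec u) (A.1.mulVec v) = wedge u v := by
  have h := A.2
  rw [Matrix.det_fin_two] at h
  simp only [wedge, Matrix.mulVec, dotProduct, Fin.sum_univ_two]
  linear_combination (u 0 * v 1 - u 1 * v 0) * h

theorem vec_one_zero_ne : (![1, 0] : Fin 2 → ℂ) ≠ 0 := fun h => by simpa using congrFun h 0

/-- The point of the projective line represented by a vector (and `∞` for the zero vector). -/
noncomputable def toPoint (v : Fin 2 → ℂ) : ℙ ℂ (Fin 2 → ℂ) :=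
  open Classical in
  if h : v = 0 then .mk ℂ ![1, 0] vec_one_zero_ne else .mk ℂ v h

theorem toPoint_of_ne {v : Fin 2 → ℂ} (h : v ≠ 0) : toPoint v = .mk ℂ v h := by
  simp [toPoint, h]

theorem toPoint_rep (z : ℙ ℂ (Fin 2 → ℂ)) : toPoint z.rep = z := by
  rw [toPoint_of_ne z.rep_nonzero, Projectivization.mk_rep]

theorem toPoint_smul {a : ℂ} (ha : a ≠ 0) (v : Fin 2 → ℂ) : toPoint (a • v) = toPoint v := by
  by_cases h : v = 0
  · simp [h]
  · rw [toPoint_of_ne h, toPoint_of_ne (smul_ne_zero ha h), Projectivization.mk_eq_mk_iff']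
    exact ⟨a, rfl⟩

theorem ne_zero_of_snd {v : Fin 2 → ℂ} (h : v 1 ≠ 0) : v ≠ 0 := fun h' => h (by simp [h'])

theorem exists_rep_toPoint {v : Fin 2 → ℂ} (h : v ≠ 0) :
    ∃ a : ℂ, a ≠ 0 ∧ (toPoint v).rep = a • v := by
  rw [toPoint_of_ne h]
  obtain ⟨a, ha⟩ := Projectivization.exists_smul_eq_mk_rep ℂ v h
  exact ⟨a, a.ne_zero, ha.symm⟩

theorem mulVec_ne_zero (A : Matrix.SpecialLinearGroup (Fin 2) ℂ) {v : Fin 2 → ℂ} (h : v ≠ 0) :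
    A.1.mulVec v ≠ 0 := by
  intro h'
  apply h
  have : (A⁻¹.1 * A.1).mulVec v = 0 := by rw [← Matrix.mulVec_mulVec, h', Matrix.mulVec_zero]
  rwa [← Matrix.SpecialLinearGroup.coe_mul, inv_mul_cancel, Matrix.SpecialLinearGroup.coe_one,
    Matrix.one_mulVec] at this

theorem smul_toPoint (A : Matrix.SpecialLinearGroup (Fin 2) ℂ) {v : Fin 2 → ℂ} (h : v ≠ 0) :
    (A : Matrix.ProjectiveSpecialLinearGroup (Fin 2) ℂ) • toPoint v = toPoint (A.1.mulVec v) := by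
  rw [Matrix.ProjectiveSpecialLinearGroup.smul_proj_mk, toPoint_of_ne h,
    toPoint_of_ne (mulVec_ne_zero A h), Projectivization.matrixSpecialLinearGroup_smul_def,
    Projectivization.smul_mk]
  rfl

/-- Each index occurs once in the numerator and once in the denominator, so the scalars cancel. -/
theorem crossRatio_eq_of_rep {z : Fin 4 → ℙ ℂ (Fin 2 → ℂ)} {v : Fin 4 → Fin 2 → ℂ}
    (h : ∀ i, ∃ a : ℂ, a ≠ 0 ∧ (z i).rep = a • v i) :
    crossRatio z =
      wedge (v 0) (v 3) * wedge (v 1) (v 2) / (wedge (v 0) (v 2) * wedge (v 1) (v 3)) := by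
  choose a ha h using h
  have h0 := ha 0
  have h1 := ha 1
  have h2 := ha 2
  have h3 := ha 3
  simp only [crossRatio, det_pair, h, wedge_smul_left, wedge_smul_right]
  rw [show a 3 * (a 0 * wedge (v 0) (v 3)) * (a 2 * (a 1 * wedge (v 1) (v 2))) =
      (a 0 * a 1 * a 2 * a 3) * (wedge (v 0) (v 3) * wedge (v 1) (v 2)) by ring,
    show a 2 * (a 0 * wedge (v 0) (v 2)) * (a 3 * (a 1 * wedge (v 1) (v 3))) =
      (a 0 * a 1 * a 2 * a 3) * (wedge (v 0) (v 2) * wedge (v 1) (v 3)) by ring]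
  exact mul_div_mul_left _ _ (by simp [h0, h1, h2, h3])

theorem crossRatio_toPoint {v : Fin 4 → Fin 2 → ℂ} (h : ∀ i, v i ≠ 0) :
    crossRatio (fun i => toPoint (v i)) =
      wedge (v 0) (v 3) * wedge (v 1) (v 2) / (wedge (v 0) (v 2) * wedge (v 1) (v 3)) :=
  crossRatio_eq_of_rep fun i => exists_rep_toPoint (h i)

theorem crossRatio_eq_wedge (z : Fin 4 → ℙ ℂ (Fin 2 → ℂ)) :
    crossRatio z = wedge (z 0).rep (z 3).rep * wedge (z 1).rep (z 2).rep /
      (wedge (z 0).rep (z 2).rep * wedge (z 1).rep (z 3).rep) :=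
  crossRatio_eq_of_rep (v := fun i => (z i).rep) fun _ => ⟨1, one_ne_zero, (one_smul ℂ _).symm⟩

theorem crossRatio_smul (g : Matrix.ProjectiveSpecialLinearGroup (Fin 2) ℂ)
    (z : Fin 4 → ℙ ℂ (Fin 2 → ℂ)) : crossRatio (fun i => g • z i) = crossRatio z := by
  obtain ⟨A, rfl⟩ := QuotientGroup.mk_surjective g
  have hz : ∀ i, (A : Matrix.ProjectiveSpecialLinearGroup (Fin 2) ℂ) • z i =
      toPoint (A.1.mulVec (z i).rep) := fun i => by
    rw [← smul_toPoint A (z i).rep_nonzero, toPoint_rep]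
  simp only [hz]
  rw [crossRatio_toPoint fun _ => mulVec_ne_zero A (Projectivization.rep_nonzero _),
    crossRatio_eq_wedge]
  simp only [wedge_mulVec]

theorem eq_of_wedge_rep {z z' : ℙ ℂ (Fin 2 → ℂ)} (h : wedge z.rep z'.rep = 0) : z = z' := by
  have h0 := z.rep_nonzero
  rw [← Projectivization.mk_rep z, ← Projectivization.mk_rep z', Projectivization.mk_eq_mk_iff']
  have h0' := z'.rep_nonzero
  generalize z.rep = u at *
  generalize z'.rep = v at *
  simp only [wedge] at h
  by_cases hv : v 0 = 0
  · have hv1 : v 1 ≠ 0 := fun h1 => h0' (by ext i; fin_cases i <;> simp [hv, h1])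
    have hu : u 0 = 0 := by simpa [hv, hv1] using h
    exact ⟨u 1 / v 1, by ext i; fin_cases i <;> simp [hv, hv1, hu]⟩
  · refine ⟨u 0 / v 0, ?_⟩
    ext i
    fin_cases i
    · simp [hv]
    · simp only [Pi.smul_apply, smul_eq_mul, Fin.mk_one, Fin.isValue]
      field_simp
      linear_combination h

theorem wedge_rep_ne {z z' : ℙ ℂ (Fin 2 → ℂ)} (h : z ≠ z') : wedge z.rep z'.rep ≠ 0 :=
  fun h' => h (eq_of_wedge_rep h')

theorem wedge_self (u : Fin 2 → ℂ) : wedge u u = 0 := by simp [wedge]; ring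

theorem wedge_swap (u v : Fin 2 → ℂ) : wedge u v = -wedge v u := by simp [wedge]; ring

theorem plucker (a b c d : Fin 2 → ℂ) :
    wedge a c * wedge b d - wedge a d * wedge b c = wedge a b * wedge c d := by
  simp [wedge]; ring

/-- Two coinciding points make a factor of the numerator or of the denominator vanish, and division
by zero also gives the value 0; for the pairs 01 and 23 the Plücker relation makes numerator and
denominator equal instead. -/
theorem injective_of_crossRatio {z : Fin 4 → ℙ ℂ (Fin 2 → ℂ)} (h0 : crossRatio z ≠ 0)
    (h1 : crossRatio z ≠ 1) : Function.Injective z := by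
  rw [crossRatio_eq_wedge] at h0 h1
  have hp := plucker (z 0).rep (z 1).rep (z 2).rep (z 3).rep
  have h03 : z 0 ≠ z 3 := fun h => h0 (by simp [h, wedge_self])
  have h12 : z 1 ≠ z 2 := fun h => h0 (by simp [h, wedge_self])
  have h02 : z 0 ≠ z 2 := fun h => h0 (by simp [h, wedge_self])
  have h13 : z 1 ≠ z 3 := fun h => h0 (by simp [h, wedge_self])
  have key : wedge (z 0).rep (z 1).rep * wedge (z 2).rep (z 3).rep ≠ 0 := by
    rw [← hp]
    intro h
    apply h1
    rw [sub_eq_zero] at h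
    rw [h, div_self]
    exact mul_ne_zero (wedge_rep_ne h03) (wedge_rep_ne h12)
  have h01 : z 0 ≠ z 1 := fun h => key (by simp [h, wedge_self])
  have h23 : z 2 ≠ z 3 := fun h => key (by simp [h, wedge_self])
  intro i j hij
  fin_cases i <;> fin_cases j <;> first | rfl | (exfalso; simp_all)

/-- With denominators cleared, the Plücker relation turns the equality into a non-zero multiple of
the determinant of `z i` and `z' i`. -/
theorem eq_of_crossRatio {z z' : Fin 4 → ℙ ℂ (Fin 2 → ℂ)} (hz : Function.Injective z)
    (h : crossRatio z = crossRatio z') (i : Fin 4) (hi : ∀ j, j ≠ i → z j = z' j) :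
    z = z' := by
  suffices hzi : z i = z' i by
    funext j
    by_cases hj : j = i
    · rw [hj, hzi]
    · exact hi j hj
  have hw : ∀ a b : Fin 4, a ≠ b → wedge (z a).rep (z b).rep ≠ 0 := fun a b hab =>
    wedge_rep_ne (hz.ne hab)
  have h01 := hw 0 1 (by decide)
  have h02 := hw 0 2 (by decide)
  have h03 := hw 0 3 (by decide)
  have h12 := hw 1 2 (by decide)
  have h13 := hw 1 3 (by decide)
  have h23 := hw 2 3 (by decide)
  -- The points of `z'` are not assumed distinct; a non-zero value rules out the convention for
  -- division by zero.
  have hne : crossRatio z' ≠ 0 := by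
    rw [← h, crossRatio_eq_wedge]
    exact div_ne_zero (mul_ne_zero h03 h12) (mul_ne_zero h02 h13)
  rw [crossRatio_eq_wedge z'] at h hne
  rw [crossRatio_eq_wedge] at h
  have h02' : wedge (z' 0).rep (z' 2).rep ≠ 0 := fun h' => hne (by simp [h'])
  have h13' : wedge (z' 1).rep (z' 3).rep ≠ 0 := fun h' => hne (by simp [h'])
  rw [div_eq_div_iff (mul_ne_zero h02 h13) (mul_ne_zero h02' h13')] at h
  apply eq_of_wedge_rep
  fin_cases i <;> simp only [Fin.zero_eta, Fin.mk_one, Fin.reduceFinMk, Fin.isValue] at hi ⊢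
  · rw [← hi 1 (by decide), ← hi 2 (by decide), ← hi 3 (by decide)] at *
    have := plucker (z 0).rep (z' 0).rep (z 2).rep (z 3).rep
    have key : (wedge (z 1).rep (z 2).rep * wedge (z 1).rep (z 3).rep) *
        (wedge (z 0).rep (z' 0).rep * wedge (z 2).rep (z 3).rep) = 0 := by
      linear_combination (-(wedge (z 1).rep (z 2).rep * wedge (z 1).rep (z 3).rep)) * this - h
    simpa [h01, h02, h03, h12, h13, h23] using key
  · rw [← hi 0 (by decide), ← hi 2 (by decide), ← hi 3 (by decide)] at *
    have := plucker (z 1).rep (z' 1).rep (z 2).rep (z 3).rep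
    have key : (wedge (z 0).rep (z 3).rep * wedge (z 0).rep (z 2).rep) *
        (wedge (z 1).rep (z' 1).rep * wedge (z 2).rep (z 3).rep) = 0 := by
      linear_combination (-(wedge (z 0).rep (z 2).rep * wedge (z 0).rep (z 3).rep)) * this + h
    simpa [h01, h02, h03, h12, h13, h23] using key
  · rw [← hi 0 (by decide), ← hi 1 (by decide), ← hi 3 (by decide)] at *
    have := plucker (z 0).rep (z 1).rep (z 2).rep (z' 2).rep
    have key : (wedge (z 0).rep (z 3).rep * wedge (z 1).rep (z 3).rep) *
        (wedge (z 0).rep (z 1).rep * wedge (z 2).rep (z' 2).rep) = 0 := by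
      linear_combination (-(wedge (z 0).rep (z 3).rep * wedge (z 1).rep (z 3).rep)) * this - h
    simpa [h01, h02, h03, h12, h13, h23] using key
  · rw [← hi 0 (by decide), ← hi 1 (by decide), ← hi 2 (by decide)] at *
    have := plucker (z 0).rep (z 1).rep (z 3).rep (z' 3).rep
    have key : (wedge (z 1).rep (z 2).rep * wedge (z 0).rep (z 2).rep) *
        (wedge (z 0).rep (z 1).rep * wedge (z 3).rep (z' 3).rep) = 0 := by
      linear_combination (-(wedge (z 0).rep (z 2).rep * wedge (z 1).rep (z 2).rep)) * this + h
    simpa [h01, h02, h03, h12, h13, h23] using key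

/-- The cross-ratio with the three fixed points determines every further point, and the action is
faithful. -/
theorem eq_one_of_fixes_three {g : Matrix.ProjectiveSpecialLinearGroup (Fin 2) ℂ}
    {a b c : ℙ ℂ (Fin 2 → ℂ)} (hab : a ≠ b) (hac : a ≠ c) (hbc : b ≠ c)
    (ha : g • a = a) (hb : g • b = b) (hc : g • c = c) : g = 1 := by
  refine eq_of_smul_eq_smul (α := ℙ ℂ (Fin 2 → ℂ)) fun x => ?_
  rw [one_smul]
  by_cases hxa : x = a
  · rw [hxa, ha]
  by_cases hxb : x = b
  · rw [hxb, hb]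
  by_cases hxc : x = c
  · rw [hxc, hc]
  have hinj : Function.Injective ![a, b, c, x] := by
    intro i j hij
    fin_cases i <;> fin_cases j <;> first
      | rfl
      | exact absurd hij hab
      | exact absurd hij hac
      | exact absurd hij hbc
      | exact absurd hij hxa
      | exact absurd hij hxb
      | exact absurd hij hxc
      | exact absurd hij.symm hab
      | exact absurd hij.symm hac
      | exact absurd hij.symm hbc
      | exact absurd hij.symm hxa
      | exact absurd hij.symm hxb
      | exact absurd hij.symm hxc
  have := eq_of_crossRatio hinj (crossRatio_smul g ![a, b, c, x]).symm 3 (by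
    intro j hj
    fin_cases j <;> simp_all)
  exact (congrFun this 3).symm

theorem exists_smul_standard {a b c : ℙ ℂ (Fin 2 → ℂ)} (hab : a ≠ b) (hac : a ≠ c)
    (hbc : b ≠ c) : ∃ g : Matrix.ProjectiveSpecialLinearGroup (Fin 2) ℂ,
      g • toPoint ![1, 0] = a ∧ g • toPoint ![0, 1] = b ∧ g • toPoint ![1, 1] = c := by
  have h01 := wedge_rep_ne hab
  have h02 := wedge_rep_ne hac
  have h12 := wedge_rep_ne hbc
  rw [← toPoint_rep a, ← toPoint_rep b, ← toPoint_rep c]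
  generalize a.rep = u at *
  generalize b.rep = v at *
  generalize c.rep = t at *
  -- The columns of the matrix will be multiples of `u` and `v` whose sum is `s * wedge u v` times
  -- `t`; this choice of `s` makes the determinant one.
  obtain ⟨s, hs⟩ := IsAlgClosed.exists_pow_nat_eq
    (-(wedge u v * wedge u t * wedge v t))⁻¹ (n := 2) (by norm_num)
  have hne : wedge u v * wedge u t * wedge v t ≠ 0 := by simp [h01, h02, h12]
  have hs0 : s ≠ 0 := by
    rintro rfl
    rw [zero_pow two_ne_zero, eq_comm, inv_eq_zero, neg_eq_zero] at hs
    exact hne hs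
  have hs2 : s ^ 2 * (-(wedge u v * wedge u t * wedge v t)) = 1 := by
    rw [hs]
    exact inv_mul_cancel₀ (neg_ne_zero.mpr hne)
  let A : Matrix.SpecialLinearGroup (Fin 2) ℂ :=
    ⟨!![-(s * wedge v t) * u 0, s * wedge u t * v 0; -(s * wedge v t) * u 1, s * wedge u t * v 1],
      by
        rw [Matrix.det_fin_two_of, ← hs2]
        simp only [wedge]
        ring⟩
  refine ⟨A, ?_, ?_, ?_⟩
  · rw [smul_toPoint A vec_one_zero_ne,
      ← toPoint_smul (neg_ne_zero.mpr (mul_ne_zero hs0 h12)) u]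
    congr 1
    ext i
    fin_cases i <;> simp [A, Matrix.mulVec, dotProduct, Fin.sum_univ_two]
  · rw [smul_toPoint A (ne_zero_of_snd (by simp)), ← toPoint_smul (mul_ne_zero hs0 h02) v]
    congr 1
    ext i
    fin_cases i <;> simp [A, Matrix.mulVec, dotProduct, Fin.sum_univ_two]
  · rw [smul_toPoint A (ne_zero_of_snd (by simp)), ← toPoint_smul (mul_ne_zero hs0 h01) t]
    congr 1
    ext i
    fin_cases i <;> simp [A, Matrix.mulVec, dotProduct, Fin.sum_univ_two, wedge] <;> ring

theorem exists_smul_eq_three {a b c a' b' c' : ℙ ℂ (Fin 2 → ℂ)} (hab : a ≠ b) (hac : a ≠ c)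
    (hbc : b ≠ c) (hab' : a' ≠ b') (hac' : a' ≠ c') (hbc' : b' ≠ c') :
    ∃ g : Matrix.ProjectiveSpecialLinearGroup (Fin 2) ℂ, g • a = a' ∧ g • b = b' ∧ g • c = c' := by
  obtain ⟨g, rfl, rfl, rfl⟩ := exists_smul_standard hab hac hbc
  obtain ⟨g', rfl, rfl, rfl⟩ := exists_smul_standard hab' hac' hbc'
  exact ⟨g' * g⁻¹, by simp [mul_smul]⟩

/-! ## Matrices with determinant one -/

/-- The centre of `SL(2, ℂ)` consists of the scalar matrices whose entry has square one. -/
theorem coe_eq_coe_psl {A B : Matrix.SpecialLinearGroup (Fin 2) ℂ}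
    (h : (A : Matrix.ProjectiveSpecialLinearGroup (Fin 2) ℂ) = B) :
    ∃ ε : ℂ, (ε = 1 ∨ ε = -1) ∧ A.1 = ε • B.1 := by
  have h' : B⁻¹ * A ∈ Subgroup.center (Matrix.SpecialLinearGroup (Fin 2) ℂ) :=
    QuotientGroup.eq.mp h.symm
  obtain ⟨r, hr, hs⟩ := Matrix.SpecialLinearGroup.mem_center_iff.mp h'
  refine ⟨r, by simpa using hr, ?_⟩
  have : A.1 = B.1 * (B⁻¹ * A).1 := by
    rw [← Matrix.SpecialLinearGroup.coe_mul, mul_inv_cancel_left]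
  rw [this, ← hs, Matrix.scalar_apply, ← Matrix.smul_eq_mul_diagonal]

theorem roots_charpoly_of_trace (A : Matrix.SpecialLinearGroup (Fin 2) ℂ) {x y : ℂ}
    (hxy : x * y = 1) (h : A.1.trace = x + y) : A.1.charpoly.roots = {x, y} := by
  have : A.1.charpoly =
      (({x, y} : Multiset ℂ).map fun a => Polynomial.X - Polynomial.C a).prod := by
    rw [Matrix.charpoly_fin_two, h, A.2]
    simp only [Multiset.insert_eq_cons, Multiset.map_cons, Multiset.map_singleton,
      Multiset.prod_cons, Multiset.prod_singleton]
    have hc : Polynomial.C x * Polynomial.C y = 1 := by rw [← Polynomial.C_mul, hxy, map_one]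
    rw [map_add, map_one]
    linear_combination -hc
  rw [this, Polynomial.roots_multiset_prod_X_sub_C]

/-- Two matrices of determinant one with the same trace which agree on a vector agree on its image,
too. -/
theorem mulVec_mulVec_of_trace (A : Matrix.SpecialLinearGroup (Fin 2) ℂ) (v : Fin 2 → ℂ) :
    A.1.mulVec (A.1.mulVec v) = A.1.trace • A.1.mulVec v - v := by
  have h := A.2
  rw [Matrix.det_fin_two] at h
  ext i
  fin_cases i <;>
    simp only [Matrix.mulVec, dotProduct, Fin.sum_univ_two, Matrix.trace_fin_two, Pi.sub_apply,
      Pi.smul_apply, smul_eq_mul, Fin.zero_eta, Fin.mk_one, Fin.isValue]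
  · linear_combination -v 0 * h
  · linear_combination -v 1 * h

theorem sl_ext_of_wedge {A B : Matrix.SpecialLinearGroup (Fin 2) ℂ} {u v : Fin 2 → ℂ}
    (huv : wedge u v ≠ 0) (hu : A.1.mulVec u = B.1.mulVec u) (hv : A.1.mulVec v = B.1.mulVec v) :
    A = B := by
  ext i j
  have hui := congrFun hu i
  have hvi := congrFun hv i
  simp only [Matrix.mulVec, dotProduct, Fin.sum_univ_two] at hui hvi
  apply mul_left_cancel₀ huv
  fin_cases j <;> simp only [wedge, Fin.zero_eta, Fin.mk_one, Fin.isValue]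
  · linear_combination v 1 * hui - u 1 * hvi
  · linear_combination u 0 * hvi - v 0 * hui

/-- If `C` carries the pair `(u, v)` to `(u', v')`, then it conjugates a matrix which maps `u` to
`v` to any matrix with the same trace which maps `u'` to `v'`. -/
theorem mul_eq_mul_of_trace {A B C : Matrix.SpecialLinearGroup (Fin 2) ℂ} {u v u' v' : Fin 2 → ℂ}
    (huv : wedge u v ≠ 0) (hA : A.1.mulVec u = v) (hB : B.1.mulVec u' = v')
    (hu : C.1.mulVec u = u') (hv : C.1.mulVec v = v') (ht : A.1.trace = B.1.trace) :
    C * A = B * C := by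
  apply sl_ext_of_wedge huv
  · simp only [Matrix.SpecialLinearGroup.coe_mul, ← Matrix.mulVec_mulVec, hA, hu, hv, hB]
  · have h1 := mulVec_mulVec_of_trace A u
    have h2 := mulVec_mulVec_of_trace B u'
    rw [hA] at h1
    rw [hB] at h2
    simp only [Matrix.SpecialLinearGroup.coe_mul, ← Matrix.mulVec_mulVec, h1, hv, h2,
      Matrix.mulVec_sub, Matrix.mulVec_smul, hu, ht]

namespace OrientedDiagram

variable (D : OrientedDiagram)

/-! ## Edges, their sides, and cochains on the sphere -/

/-- The region on the given side of an edge. -/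
def sideRegion (e : D.Edge) (d : Side) : D.Region := D.region e.1 (cornerAt e.2 .out d)

/-- The edge which contains a half-strand. -/
def edgeAt (c : D.Crossing) (s : Strand) : Half → D.Edge
  | .out => (c, s)
  | .inc => D.inEdge c s

theorem next_inEdge (c : D.Crossing) (s : Strand) : D.next (D.inEdge c s) = (c, s) := by
  simp [inEdge]

theorem region_cornerAt_next (e : D.Edge) (d : Side) :
    D.region (D.next e).1 (cornerAt (D.next e).2 .inc d) = D.sideRegion e d :=
  (Quot.sound (CornerAdj.along e d)).symm

theorem region_cornerAt (c : D.Crossing) (s : Strand) (h : Half) (d : Side) :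
    D.region c (cornerAt s h d) = D.sideRegion (D.edgeAt c s h) d := by
  cases h
  · rfl
  · have := D.region_cornerAt_next (D.inEdge c s) d
    rwa [next_inEdge] at this

theorem component_next (e : D.Edge) : D.component (D.next e) = D.component e := by
  symm
  exact Quot.sound rfl

theorem component_edgeAt (c : D.Crossing) (s : Strand) (h : Half) :
    D.component (D.edgeAt c s h) = D.component (c, s) := by
  cases h
  · rfl
  · rw [← D.component_next, edgeAt, next_inEdge]

/-- A property of edges which is invariant under continuing through crossings is a property of
components. -/
theorem iff_of_component_eq {p : D.Edge → Prop} (h : ∀ e, p e ↔ p (D.next e)) {e e' : D.Edge}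
    (he : D.component e = D.component e') : p e ↔ p e' := by
  have := congrArg (Quot.lift p fun a b hab => by rw [← hab]; exact propext (h a)) he
  exact iff_of_eq this

instance : Finite Corner :=
  Finite.of_surjective (fun n : Fin 4 => ![Corner.j, .k, .l, .m] n) fun q => by
    cases q
    exacts [⟨0, rfl⟩, ⟨1, rfl⟩, ⟨2, rfl⟩, ⟨3, rfl⟩]

instance : Finite D.Region := Quot.finite _

noncomputable instance : Fintype D.Region := Fintype.ofFinite _

noncomputable instance : DecidableEq D.Region := Classical.decEq _

noncomputable instance : DecidableEq D.Crossing := Classical.decEq _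

variable {D}

theorem eq_of_forall_next {X : Type*} (hD : D.IsConnected) (f : D.Crossing → X)
    (hf : ∀ e : D.Edge, f e.1 = f (D.next e).1) (c c' : D.Crossing) : f c = f c' := by
  induction hD.2 c c' with
  | rel a b h =>
    obtain ⟨s, s', h⟩ := h
    rw [show b = (D.next (a, s)).1 by rw [h], ← hf]
  | refl => rfl
  | symm _ _ _ ih => exact ih.symm
  | trans _ _ _ _ _ ih ih' => exact ih.trans ih'

theorem eq_region_j {X : Type*} (f : D.Region → X)
    (hf : ∀ e : D.Edge, f (D.sideRegion e .left) = f (D.sideRegion e .right))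
    (c : D.Crossing) (q : Corner) : f (D.region c q) = f (D.region c .j) := by
  have h : ∀ s h, f (D.region c (cornerAt s h .left)) = f (D.region c (cornerAt s h .right)) :=
    fun s h => by rw [region_cornerAt, region_cornerAt, hf]
  have hk := h .alpha .out
  have hm := h .beta .out
  have hl := h .alpha .inc
  simp only [cornerAt] at hk hm hl
  cases q
  · rfl
  · exact hk
  · exact hl.trans hm.symm
  · exact hm.symm

/-- Connectedness of the dual graph: half-strands join the four corners of a crossing, and the two
ends of an edge share the regions beside it. -/
theorem eq_of_forall_side {X : Type*} (hD : D.IsConnected) (f : D.Region → X)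
    (hf : ∀ e : D.Edge, f (D.sideRegion e .left) = f (D.sideRegion e .right))
    (r r' : D.Region) : f r = f r' := by
  have key : ∀ c c', f (D.region c .j) = f (D.region c' .j) :=
    eq_of_forall_next hD (fun c => f (D.region c .j)) fun e => by
      show f (D.region e.1 .j) = f (D.region (D.next e).1 .j)
      rw [← eq_region_j f hf (D.next e).1 (cornerAt (D.next e).2 .inc .left),
        region_cornerAt_next, ← eq_region_j f hf e.1 (cornerAt e.2 .out .left)]
      rfl
  obtain ⟨⟨c, q⟩, rfl⟩ := Quot.exists_rep r
  obtain ⟨⟨c', q'⟩, rfl⟩ := Quot.exists_rep r'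
  exact (eq_region_j f hf c q).trans ((key c c').trans (eq_region_j f hf c' q').symm)

end OrientedDiagram

/-! ### Exactness from a count of ranks -/

theorem rank_add_one_of_ker {m n : Type*} [Fintype m] [Fintype n] [Nonempty n]
    (A : Matrix m n ℂ) (h : ∀ v, A.mulVec v = 0 ↔ ∃ a : ℂ, v = fun _ => a) :
    A.rank + 1 = Fintype.card n := by
  classical
  have hker : LinearMap.ker A.mulVecLin = Submodule.span ℂ {fun _ : n => (1 : ℂ)} := by
    ext v
    rw [LinearMap.mem_ker, Matrix.mulVecLin_apply, h, Submodule.mem_span_singleton]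
    refine exists_congr fun a => ?_
    rw [eq_comm]
    refine Eq.congr ?_ rfl
    ext
    simp
  have := A.mulVecLin.finrank_range_add_finrank_ker
  rwa [hker, finrank_span_singleton (fun h => by simpa using congrFun h (Classical.arbitrary n)),
    Module.finrank_fintype_fun_eq_card] at this

/-- The image of `A` lies in the kernel of the transpose of `B`, and the rank hypothesis makes the
dimensions equal. -/
theorem exists_mulVec_eq_of_rank {e n k : Type*} [Fintype e] [Fintype n] [Fintype k]
    (A : Matrix e n ℂ) (B : Matrix e k ℂ) (hBA : B.transpose * A = 0)
    (hr : A.rank + B.rank = Fintype.card e) {f : e → ℂ} (hf : B.transpose.mulVec f = 0) :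
    ∃ v, A.mulVec v = f := by
  classical
  have hle : LinearMap.range A.mulVecLin ≤ LinearMap.ker B.transpose.mulVecLin := by
    rintro _ ⟨v, rfl⟩
    rw [LinearMap.mem_ker, Matrix.mulVecLin_apply, Matrix.mulVecLin_apply, Matrix.mulVec_mulVec,
      hBA, Matrix.zero_mulVec]
  have hfin := B.transpose.mulVecLin.finrank_range_add_finrank_ker
  have hB : Module.finrank ℂ (LinearMap.range B.transpose.mulVecLin) = B.rank := B.rank_transpose
  rw [hB, Module.finrank_fintype_fun_eq_card] at hfin
  have heq := Submodule.eq_of_le_of_finrank_eq hle (by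
    have hA : Module.finrank ℂ (LinearMap.range A.mulVecLin) = A.rank := rfl
    omega)
  have : f ∈ LinearMap.ker B.transpose.mulVecLin := hf
  rw [← heq] at this
  exact this

/-! ### Closed cochains on the sphere are exact -/

namespace OrientedDiagram

variable {D : OrientedDiagram}

/-- The incidence matrix of edges and regions. -/
noncomputable def regionMatrix (D : OrientedDiagram) : Matrix D.Edge D.Region ℂ :=
  fun e r => (if D.sideRegion e .left = r then 1 else 0) -
    if D.sideRegion e .right = r then 1 else 0

/-- The incidence matrix of edges and crossings. -/
noncomputable def crossingMatrix (D : OrientedDiagram) : Matrix D.Edge D.Crossing ℂ :=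
  fun e c => (if (D.next e).1 = c then 1 else 0) - if e.1 = c then 1 else 0

theorem regionMatrix_mulVec (Q : D.Region → ℂ) (e : D.Edge) :
    D.regionMatrix.mulVec Q e = Q (D.sideRegion e .left) - Q (D.sideRegion e .right) := by
  simp [Matrix.mulVec, dotProduct, regionMatrix, sub_mul]

theorem crossingMatrix_mulVec (s : D.Crossing → ℂ) (e : D.Edge) :
    D.crossingMatrix.mulVec s e = s (D.next e).1 - s e.1 := by
  simp [Matrix.mulVec, dotProduct, crossingMatrix, sub_mul]

theorem regionMatrix_transpose_mulVec (f : D.Edge → ℂ) (r : D.Region) :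
    D.regionMatrix.transpose.mulVec f r =
      (∑ e with D.sideRegion e .left = r, f e) - ∑ e with D.sideRegion e .right = r, f e := by
  simp only [Matrix.mulVec, dotProduct, regionMatrix, Matrix.transpose_apply, sub_mul,
    Finset.sum_sub_distrib, ite_mul, one_mul, zero_mul, Finset.sum_filter]

theorem sum_strand {M : Type*} [AddCommMonoid M] (f : Strand → M) :
    ∑ s, f s = f .alpha + f .beta := by
  rw [show (Finset.univ : Finset Strand) = {.alpha, .beta} from rfl,
    Finset.sum_pair (by decide)]

theorem crossingMatrix_transpose_mulVec (f : D.Edge → ℂ) (c : D.Crossing) :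
    D.crossingMatrix.transpose.mulVec f c =
      (f (D.inEdge c .alpha) + f (D.inEdge c .beta)) - (f (c, .alpha) + f (c, .beta)) := by
  simp only [Matrix.mulVec, dotProduct, crossingMatrix, Matrix.transpose_apply, sub_mul,
    Finset.sum_sub_distrib, ite_mul, one_mul, zero_mul]
  congr 1
  · rw [← Equiv.sum_comp D.next.symm]
    simp only [Equiv.apply_symm_apply]
    rw [Fintype.sum_prod_type, Finset.sum_eq_single c (by intro b _ hb; simp [hb]) (by simp)]
    simp [sum_strand, inEdge]
  · rw [Fintype.sum_prod_type, Finset.sum_eq_single c (by intro b _ hb; simp [hb]) (by simp)]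
    simp [sum_strand]

/-- Going once around a crossing, the differences between consecutive regions telescope. -/
theorem crossingMatrix_transpose_mul : D.crossingMatrix.transpose * D.regionMatrix = 0 := by
  apply Matrix.ext_of_mulVec_single
  intro r
  generalize Pi.single (M := fun _ => ℂ) r 1 = Q
  rw [← Matrix.mulVec_mulVec, Matrix.zero_mulVec]
  ext c
  have h : ∀ s h d, Q (D.sideRegion (D.edgeAt c s h) d) = Q (D.region c (cornerAt s h d)) :=
    fun s h d => by rw [region_cornerAt]
  rw [crossingMatrix_transpose_mulVec]
  simp only [regionMatrix_mulVec]
  have h1 := fun s => h s .inc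
  have h2 := fun s => h s .out
  simp only [edgeAt] at h1 h2
  simp only [h1, h2, cornerAt, Pi.zero_apply]
  ring

theorem rank_regionMatrix (hD : D.IsConnected) :
    D.regionMatrix.rank + 1 = Fintype.card D.Region := by
  have : Nonempty D.Region := ⟨D.region hD.1.some .j⟩
  refine rank_add_one_of_ker _ fun v => ⟨fun h => ?_, ?_⟩
  · refine ⟨v (Classical.arbitrary _), funext fun r => eq_of_forall_side hD v (fun e => ?_) _ _⟩
    rw [← sub_eq_zero, ← regionMatrix_mulVec, h, Pi.zero_apply]
  · rintro ⟨a, rfl⟩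
    ext e
    simp [regionMatrix_mulVec]

theorem rank_crossingMatrix (hD : D.IsConnected) :
    D.crossingMatrix.rank + 1 = Fintype.card D.Crossing := by
  have := hD.1
  refine rank_add_one_of_ker _ fun v => ⟨fun h => ?_, ?_⟩
  · refine ⟨v (Classical.arbitrary _), funext fun r => eq_of_forall_next hD v (fun e => ?_) _ _⟩
    rw [eq_comm, ← sub_eq_zero, ← crossingMatrix_mulVec, h, Pi.zero_apply]
  · rintro ⟨a, rfl⟩
    ext e
    simp [crossingMatrix_mulVec]

/-- Both kernels consist of the constants, so the ranks are one less than the numbers of regions and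
of crossings; Euler's formula supplies the 2. -/
theorem rank_add_rank (hD : D.IsConnected) (hS : D.IsSpherical) :
    D.regionMatrix.rank + D.crossingMatrix.rank = Fintype.card D.Edge := by
  have h1 := rank_regionMatrix hD
  have h2 := rank_crossingMatrix hD
  simp only [IsSpherical, Nat.card_eq_fintype_card] at hS
  omega

/-- On the sphere a closed dual 1-cochain is exact. -/
theorem exists_region_potential (hD : D.IsConnected) (hS : D.IsSpherical) (f : D.Edge → ℂ)
    (hf : ∀ c, f (D.inEdge c .alpha) + f (D.inEdge c .beta) = f (c, .alpha) + f (c, .beta)) :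
    ∃ Q : D.Region → ℂ, ∀ e, Q (D.sideRegion e .left) - Q (D.sideRegion e .right) = f e := by
  obtain ⟨Q, hQ⟩ := exists_mulVec_eq_of_rank D.regionMatrix D.crossingMatrix
    crossingMatrix_transpose_mul (rank_add_rank hD hS) (f := f) (by
      ext c
      rw [crossingMatrix_transpose_mulVec, hf, sub_self, Pi.zero_apply])
  exact ⟨Q, fun e => by rw [← regionMatrix_mulVec, hQ]⟩

/-- On the sphere a closed 1-cochain is exact. -/
theorem exists_crossing_potential (hD : D.IsConnected) (hS : D.IsSpherical) (f : D.Edge → ℂ)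
    (hf : ∀ r, ∑ e with D.sideRegion e .left = r, f e = ∑ e with D.sideRegion e .right = r, f e) :
    ∃ s : D.Crossing → ℂ, ∀ e, s (D.next e).1 - s e.1 = f e := by
  obtain ⟨s, hs⟩ := exists_mulVec_eq_of_rank D.crossingMatrix D.regionMatrix
    (by rw [← Matrix.transpose_transpose D.crossingMatrix, ← Matrix.transpose_mul,
      crossingMatrix_transpose_mul, Matrix.transpose_zero])
    (by rw [add_comm]; exact rank_add_rank hD hS) (f := f) (by
      ext r
      rw [regionMatrix_transpose_mulVec, hf, sub_self, Pi.zero_apply])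
  exact ⟨s, fun e => by rw [← crossingMatrix_mulVec, hs]⟩

/-- The boundary of an integral dual flow. -/
noncomputable def regionFlux (D : OrientedDiagram) : (D.Edge → ℤ) →+ (D.Region → ℤ) where
  toFun n r := (∑ e with D.sideRegion e .left = r, n e) - ∑ e with D.sideRegion e .right = r, n e
  map_zero' := by ext; simp
  map_add' a b := by
    ext r
    simp only [Pi.add_apply, Finset.sum_add_distrib]
    ring

theorem regionFlux_single (e : D.Edge) : D.regionFlux (Pi.single e 1) =
    Pi.single (D.sideRegion e .left) 1 - Pi.single (D.sideRegion e .right) 1 := by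
  ext r
  have h : ∀ d, (∑ e' with D.sideRegion e' d = r, (Pi.single e 1 : D.Edge → ℤ) e') =
      (Pi.single (D.sideRegion e d) 1 : D.Region → ℤ) r := fun d => by
    rw [Finset.sum_filter, Finset.sum_eq_single e (by intro b _ hb; simp [hb]) (by simp)]
    simp [Pi.single_apply, eq_comm]
  rw [Pi.sub_apply, ← h, ← h]
  rfl

/-- Modulo boundaries the unit masses at adjacent regions agree, hence by connectedness at all
regions, and a function of total zero is a combination of their differences. -/
theorem exists_regionFlux_eq (hD : D.IsConnected) (k : D.Region → ℤ) (hk : ∑ r, k r = 0) :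
    ∃ n, D.regionFlux n = k := by
  have hmem : ∀ r r' : D.Region,
      (Pi.single r 1 - Pi.single r' 1 : D.Region → ℤ) ∈ D.regionFlux.range := by
    intro r r'
    let f : D.Region → (D.Region → ℤ) ⧸ D.regionFlux.range :=
      fun r => QuotientAddGroup.mk (Pi.single r 1)
    have := eq_of_forall_side hD f (fun e => by
      rw [eq_comm, QuotientAddGroup.eq, neg_add_eq_sub]
      exact ⟨_, regionFlux_single e⟩) r' r
    rw [QuotientAddGroup.eq, neg_add_eq_sub] at this
    exact this
  let r₀ : D.Region := D.region hD.1.some .j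
  have : k = ∑ r, k r • (Pi.single r 1 - Pi.single r₀ 1 : D.Region → ℤ) := by
    simp only [smul_sub, Finset.sum_sub_distrib, ← Finset.sum_smul, hk, zero_smul, sub_zero]
    ext r
    simp [Pi.single_apply]
  rw [this]
  exact sum_mem fun r _ => zsmul_mem (hmem r r₀) _

/-- On the sphere a closed multiplicative 1-cochain is exact. -/
theorem exists_crossing_scale (hD : D.IsConnected) (hS : D.IsSpherical) (ω : D.Edge → ℂ)
    (hω : ∀ e, ω e ≠ 0)
    (h : ∀ r, ∏ e with D.sideRegion e .left = r, ω e = ∏ e with D.sideRegion e .right = r, ω e) :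
    ∃ s : D.Crossing → ℂ, (∀ c, s c ≠ 0) ∧ ∀ e, s (D.next e).1 = ω e * s e.1 := by
  have hlog : ∀ r, ∃ k : ℤ, (∑ e with D.sideRegion e .left = r, Complex.log (ω e)) =
      (∑ e with D.sideRegion e .right = r, Complex.log (ω e)) + k * (2 * Real.pi * Complex.I) := by
    intro r
    rw [← Complex.exp_eq_exp_iff_exists_int, Complex.exp_sum, Complex.exp_sum]
    simpa only [Complex.exp_log (hω _)] using h r
  choose k hk using hlog
  have hpi : (2 * Real.pi * Complex.I : ℂ) ≠ 0 := Complex.two_pi_I_ne_zero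
  -- Each edge has exactly one region on its left and one on its right, so summing over all regions
  -- gives the same total of logarithms on both sides.
  have hsum : ∑ r, k r = 0 := by
    have h1 := Finset.sum_congr rfl fun r (_ : r ∈ Finset.univ) => hk r
    rw [Finset.sum_add_distrib, Finset.sum_fiberwise, Finset.sum_fiberwise, left_eq_add,
      ← Finset.sum_mul] at h1
    have := (mul_eq_zero.mp h1).resolve_right hpi
    exact_mod_cast this
  obtain ⟨n, hn⟩ := exists_regionFlux_eq hD k hsum
  -- The flow `n` has boundary `k`, so shifting the logarithm at each edge by `2πi n e` removes the
  -- defect; exponentials do not see the shift.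
  obtain ⟨s, hs⟩ := exists_crossing_potential hD hS
    (fun e => Complex.log (ω e) - n e * (2 * Real.pi * Complex.I)) (by
      intro r
      simp only [Finset.sum_sub_distrib, ← Finset.sum_mul, hk r]
      have : (k r : ℂ) = (∑ e with D.sideRegion e .left = r, (n e : ℂ)) -
          ∑ e with D.sideRegion e .right = r, (n e : ℂ) := by
        rw [← hn]
        simp [regionFlux]
      rw [this]
      ring)
  refine ⟨fun c => Complex.exp (s c), fun c => Complex.exp_ne_zero _, fun e => ?_⟩
  show Complex.exp (s (D.next e).1) = ω e * Complex.exp (s e.1)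
  rw [← sub_add_cancel (s (D.next e).1) (s e.1), hs, Complex.exp_add, Complex.exp_sub,
    Complex.exp_log (hω e), Complex.exp_int_mul_two_pi_mul_I, div_one]

end OrientedDiagram

namespace OrientedDiagram

variable {D : OrientedDiagram}

/-! ## Non-degeneracy and the factors of half-strands -/

section Crossing

variable {w : D.Region → ℂ} {m : D.Component → ℂ}

theorem nondegenerate_positive (hw : ∀ r, w r ≠ 0) (hm : ∀ i, m i ≠ 0)
    (hnd : D.IsNondegenerate w m) {c : D.Crossing} (hc : D.positive c = true) :
    m (D.component (c, .beta)) * w (D.region c .j) - w (D.region c .m) ≠ 0 ∧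
    m (D.component (c, .beta)) * w (D.region c .k) - w (D.region c .l) ≠ 0 ∧
    w (D.region c .k) - m (D.component (c, .alpha)) * w (D.region c .j) ≠ 0 ∧
    w (D.region c .l) - m (D.component (c, .alpha)) * w (D.region c .m) ≠ 0 ∧
    w (D.region c .j) * w (D.region c .l) - w (D.region c .m) * w (D.region c .k) ≠ 0 := by
  have h := hnd c
  simp only [dilogArg, hc] at h
  refine ⟨fun e => h 0 ?_, fun e => h 2 ?_, fun e => h 1 ?_, fun e => h 3 ?_, fun e => h 4 ?_⟩ <;>
  · simp
    rw [div_eq_one_iff_eq (by simp [hw, hm])]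
    first
      | linear_combination e
      | linear_combination -e

theorem nondegenerate_negative (hw : ∀ r, w r ≠ 0)
    (hnd : D.IsNondegenerate w m) {c : D.Crossing} (hc : D.positive c = false) :
    m (D.component (c, .alpha)) * w (D.region c .k) - w (D.region c .j) ≠ 0 ∧
    m (D.component (c, .alpha)) * w (D.region c .l) - w (D.region c .m) ≠ 0 ∧
    w (D.region c .j) - m (D.component (c, .beta)) * w (D.region c .m) ≠ 0 ∧
    w (D.region c .k) - m (D.component (c, .beta)) * w (D.region c .l) ≠ 0 ∧
    w (D.region c .j) * w (D.region c .l) - w (D.region c .m) * w (D.region c .k) ≠ 0 := by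
  have h := hnd c
  simp only [dilogArg, hc] at h
  refine ⟨fun e => h 1 ?_, fun e => h 3 ?_, fun e => h 0 ?_, fun e => h 2 ?_, fun e => h 4 ?_⟩ <;>
  · simp
    rw [div_eq_one_iff_eq (by simp [hw])]
    first
      | linear_combination e
      | linear_combination -e

/-- Every assigned cross-ratio is one of the dilogarithm arguments at the crossing or the inverse of
one. -/
theorem shape_ne (hw : ∀ r, w r ≠ 0) (hm : ∀ i, m i ≠ 0) (hnd : D.IsNondegenerate w m)
    (c : D.Crossing) (t : Fin 5) : D.shape w m c t ≠ 0 ∧ D.shape w m c t ≠ 1 := by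
  cases hc : D.positive c
  · obtain ⟨h1, h2, h3, h4, h5⟩ := nondegenerate_negative hw hnd hc
    refine ⟨by fin_cases t <;> simp [shape, hc, hw, hm], ?_⟩
    fin_cases t <;> simp [shape, hc] <;> rw [div_eq_one_iff_eq (by simp [hw, hm])] <;> intro h
    · exact h1 (by linear_combination -h)
    · exact h2 (by linear_combination h)
    · exact h3 (by linear_combination h)
    · exact h4 (by linear_combination -h)
    · exact h5 (by linear_combination -h)
  · obtain ⟨h1, h2, h3, h4, h5⟩ := nondegenerate_positive hw hm hnd hc
    refine ⟨by fin_cases t <;> simp [shape, hc, hw, hm], ?_⟩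
    fin_cases t <;> simp [shape, hc] <;> rw [div_eq_one_iff_eq (by simp [hw, hm])] <;> intro h
    · exact h1 (by linear_combination -h)
    · exact h2 (by linear_combination h)
    · exact h3 (by linear_combination h)
    · exact h4 (by linear_combination -h)
    · exact h5 (by linear_combination h)

end Crossing

variable (D) (w : D.Region → ℂ) (m : D.Component → ℂ)

/-- The scale of an edge relative to the crossing at one of its ends. -/
noncomputable def weight (c : D.Crossing) (s : Strand) (h : Half) : ℂ :=
  if s = D.overStrand c then
    m (D.component (c, s)) * w (D.region c (cornerAt s h .left)) -
      w (D.region c (cornerAt s h .right))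
  else
    m (D.component (c, s)) *
      (w (D.region c .j) * w (D.region c .l) - w (D.region c .m) * w (D.region c .k)) /
      (w (D.region c (cornerAt s h .left)) -
        m (D.component (c, s)) * w (D.region c (cornerAt s h .right)))

/-- The contribution of a side of a half-strand to the product around a regional edge. -/
noncomputable def regionFactor (c : D.Crossing) (s : Strand) : Half → Side → ℂ
  | .out, .left => D.weight w m c s .out
  | .out, .right => m (D.component (c, s)) / D.weight w m c s .out
  | .inc, .left => (D.weight w m c s .inc)⁻¹
  | .inc, .right => D.weight w m c s .inc / m (D.component (c, s))

/-- The product of the cross-ratios around the equatorial edge in a corner. -/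
noncomputable def cornerFactor (c : D.Crossing) : Corner → ℂ
  | .j => D.regionFactor w m c .beta .out .left * D.regionFactor w m c .alpha .out .right
  | .k => D.regionFactor w m c .alpha .out .left * D.regionFactor w m c .beta .inc .left
  | .l => D.regionFactor w m c .beta .inc .right * D.regionFactor w m c .alpha .inc .left
  | .m => D.regionFactor w m c .beta .out .right * D.regionFactor w m c .alpha .inc .right

variable {D w m}

theorem weight_ne_zero (hw : ∀ r, w r ≠ 0) (hm : ∀ i, m i ≠ 0) (hnd : D.IsNondegenerate w m)
    (c : D.Crossing) (s : Strand) (h : Half) : D.weight w m c s h ≠ 0 := by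
  cases hc : D.positive c
  · obtain ⟨h1, h2, h3, h4, h5⟩ := nondegenerate_negative hw hnd hc
    cases s <;> cases h <;> simp [weight, overStrand, cornerAt, *]
  · obtain ⟨h1, h2, h3, h4, h5⟩ := nondegenerate_positive hw hm hnd hc
    cases s <;> cases h <;> simp [weight, overStrand, cornerAt, *]

/-! ## Derivatives of the potential function -/

end OrientedDiagram

/-- The function `f` has a logarithmic derivative `n / t` at `t`. -/
def HasLogDerivAt (f : ℂ → ℂ) (n t : ℂ) : Prop := HasDerivAt f (n * f t / t) t

theorem HasLogDerivAt.mul {f g : ℂ → ℂ} {a b t : ℂ} (hf : HasLogDerivAt f a t)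
    (hg : HasLogDerivAt g b t) : HasLogDerivAt (fun x => f x * g x) (a + b) t := by
  have := HasDerivAt.mul hf hg
  exact this.congr_deriv (by ring)

theorem HasLogDerivAt.div {f g : ℂ → ℂ} {a b t : ℂ} (hf : HasLogDerivAt f a t)
    (hg : HasLogDerivAt g b t) (h : g t ≠ 0) :
    HasLogDerivAt (fun x => f x / g x) (a - b) t := by
  have := HasDerivAt.div hf hg h
  exact this.congr_deriv (by field_simp)

theorem HasLogDerivAt.const_mul {f : ℂ → ℂ} {a t : ℂ} (b : ℂ) (hf : HasLogDerivAt f a t) :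
    HasLogDerivAt (fun x => b * f x) a t := by
  have := HasDerivAt.const_mul b hf
  exact this.congr_deriv (by ring)

theorem HasLogDerivAt.dilog_comp {f F : ℂ → ℂ} {a t : ℂ} (hf : HasLogDerivAt f a t)
    (hF : IsDilogBranchAt F (f t)) :
    HasDerivAt (fun x => F (f x)) (a * (f t * deriv F (f t)) / t) t := by
  obtain ⟨U, hU, -, -, hx, hd, -⟩ := hF
  have := (hd.differentiableAt (hU.mem_nhds hx)).hasDerivAt.comp t hf
  exact this.congr_deriv (by ring)

theorem HasLogDerivAt.log_comp {f ℓ : ℂ → ℂ} {a t : ℂ} (hf : HasLogDerivAt f a t)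
    (hF : IsLogBranchAt ℓ (f t)) :
    HasDerivAt (fun x => ℓ (f x)) (a / t) t := by
  obtain ⟨han, he⟩ := hF
  have h1 := han.differentiableAt.hasDerivAt
  -- Differentiating `exp ∘ ℓ = id` shows that every branch of the logarithm has derivative `1 / x`.
  have h2 := h1.cexp.congr_of_eventuallyEq (he.mono fun _ h => h.symm)
  have h3 := h2.unique (hasDerivAt_id _)
  rw [he.self_of_nhds] at h3
  have := h1.comp t hf
  exact this.congr_deriv (by linear_combination a / t * h3)

namespace OrientedDiagram

variable {D : OrientedDiagram} {w : D.Region → ℂ} {m : D.Component → ℂ}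

/-- The arguments are Laurent monomials in the region variables, so logarithmic derivatives simply
add with the exponents. -/
theorem hasLogDerivAt_dilogArg {W : ℂ → D.Region → ℂ} {ε : D.Region → ℂ} {t : ℂ}
    (hW : ∀ r, HasLogDerivAt (fun x => W x r) (ε r) t) (h0 : ∀ r, W t r ≠ 0)
    (hm : ∀ i, m i ≠ 0) (c : D.Crossing) :
    HasLogDerivAt (fun x => D.dilogArg (W x) m c 0)
      (ε (D.region c .m) - ε (D.region c .j)) t ∧
    HasLogDerivAt (fun x => D.dilogArg (W x) m c 1)
      (ε (D.region c .k) - ε (D.region c .j)) t ∧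
    HasLogDerivAt (fun x => D.dilogArg (W x) m c 2)
      (ε (D.region c .l) - ε (D.region c .k)) t ∧
    HasLogDerivAt (fun x => D.dilogArg (W x) m c 3)
      (ε (D.region c .l) - ε (D.region c .m)) t ∧
    HasLogDerivAt (fun x => D.dilogArg (W x) m c 4)
      (ε (D.region c .j) + ε (D.region c .l) - (ε (D.region c .m) + ε (D.region c .k))) t := by
  have h4 := ((hW (D.region c .j)).mul (hW (D.region c .l))).div
    ((hW (D.region c .m)).mul (hW (D.region c .k))) (mul_ne_zero (h0 _) (h0 _))
  cases hc : D.positive c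
  · have key : ∀ a q q', HasLogDerivAt (fun x => a * W x q / W x q') (ε q - ε q') t :=
      fun a q q' => ((hW q).const_mul a).div (hW q') (h0 _)
    simp only [dilogArg, hc]
    exact ⟨key _ _ _, key _ _ _, key _ _ _, key _ _ _, h4⟩
  · have key : ∀ i q q', HasLogDerivAt (fun x => W x q / (m i * W x q')) (ε q - ε q') t :=
      fun i q q' => (hW q).div ((hW q').const_mul (m i)) (mul_ne_zero (hm i) (h0 _))
    simp only [dilogArg, hc]
    exact ⟨key _ _ _, key _ _ _, key _ _ _, key _ _ _, h4⟩

/-- The logarithmic derivative of the contribution of a crossing in the direction of a corner. -/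
noncomputable def cornerDeriv (B : Branches) (w : D.Region → ℂ) (m : D.Component → ℂ)
    (c : D.Crossing) (q : Corner) : ℂ :=
  let A := fun i => D.dilogArg w m c i * deriv (B.dilog i) (D.dilogArg w m c i)
  let L := fun i => B.log i (D.logArg w m c i)
  (if D.positive c then 1 else -1) *
  match q with
  | .j => -A 0 - A 1 + A 4 - L 0 - L 1
  | .k => A 1 + A 2 - A 4 + L 0
  | .l => -A 2 - A 3 + A 4
  | .m => A 0 + A 3 - A 4 + L 1

/-- The four corners are treated as independent directions weighted by `ε`, because one region may
occupy several corners of the same crossing. -/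
theorem hasDerivAt_crossingPotential {B : Branches} {c : D.Crossing}
    (hd : ∀ i, IsDilogBranchAt (B.dilog i) (D.dilogArg w m c i))
    (hl : ∀ i, IsLogBranchAt (B.log i) (D.logArg w m c i)) (hw : ∀ r, w r ≠ 0)
    (hm : ∀ i, m i ≠ 0) {W : ℂ → D.Region → ℂ} {ε : D.Region → ℂ} {t : ℂ} (hWt : W t = w)
    (hW : ∀ r, HasLogDerivAt (fun x => W x r) (ε r) t) :
    HasDerivAt (fun x => D.crossingPotential B (W x) m c)
      ((ε (D.region c .j) * cornerDeriv B w m c .j + ε (D.region c .k) * cornerDeriv B w m c .k +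
        ε (D.region c .l) * cornerDeriv B w m c .l + ε (D.region c .m) * cornerDeriv B w m c .m) /
        t) t := by
  subst hWt
  obtain ⟨h0, h1, h2, h3, h4⟩ := hasLogDerivAt_dilogArg hW hw hm c
  have l0 := h0.log_comp (hl 0)
  have l1 := h1.log_comp (hl 1)
  have := ((((((h0.dilog_comp (hd 0)).add (h1.dilog_comp (hd 1))).sub (h2.dilog_comp (hd 2))).sub
    (h3.dilog_comp (hd 3))).add (h4.dilog_comp (hd 4))).sub_const ((Real.pi : ℂ) ^ 2 / 6)).add
    (l0.mul l1)
  have := this.const_mul (if D.positive c then (1 : ℂ) else -1)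
  refine HasDerivAt.congr_deriv this ?_
  simp only [cornerDeriv, logArg, Matrix.cons_val_zero, Matrix.cons_val_one]
  ring

/-- Exponentiation removes the branches: a dilogarithm term becomes `(1 - x)⁻¹`, a logarithm its
argument. What remains is an identity of rational functions. -/
theorem exp_cornerDeriv {B : Branches} {c : D.Crossing}
    (hd : ∀ i, IsDilogBranchAt (B.dilog i) (D.dilogArg w m c i))
    (hl : ∀ i, IsLogBranchAt (B.log i) (D.logArg w m c i)) (hw : ∀ r, w r ≠ 0)
    (hm : ∀ i, m i ≠ 0) (hnd : D.IsNondegenerate w m) (q : Corner) :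
    Complex.exp (cornerDeriv B w m c q) = D.cornerFactor w m c q := by
  have hA : ∀ i, Complex.exp (D.dilogArg w m c i * deriv (B.dilog i) (D.dilogArg w m c i)) =
      (1 - D.dilogArg w m c i)⁻¹ := fun i => by
    obtain ⟨U, -, -, -, hx, -, -, he⟩ := hd i
    rw [← he _ hx, Complex.exp_neg, inv_inv]
  have hL : ∀ i, Complex.exp (B.log i (D.logArg w m c i)) = D.logArg w m c i :=
    fun i => (hl i).2.self_of_nhds
  have hj := hw (D.region c .j)
  have hk := hw (D.region c .k)
  have hl := hw (D.region c .l)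
  have hm' := hw (D.region c .m)
  have ha := hm (D.component (c, .alpha))
  have hb := hm (D.component (c, .beta))
  cases hc : D.positive c
  · obtain ⟨h1, h2, h3, h4, h5⟩ := nondegenerate_negative hw hnd hc
    cases q <;>
    simp only [cornerDeriv, hc, Bool.false_eq_true, if_false, neg_one_mul, neg_add,
      sub_eq_add_neg, neg_neg, Complex.exp_add, Complex.exp_neg, hA, hL] <;>
    simp only [logArg, dilogArg, hc, cornerFactor, regionFactor, weight, overStrand, cornerAt,
      Bool.false_eq_true, if_false, if_true, reduceCtorEq, Matrix.cons_val, ← sub_eq_add_neg]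
    all_goals
      generalize w (D.region c .j) = wj at *
      generalize w (D.region c .k) = wk at *
      generalize w (D.region c .l) = wl at *
      generalize w (D.region c .m) = wm at *
      generalize m (D.component (c, .alpha)) = ma at *
      generalize m (D.component (c, .beta)) = mb at *
      rw [show 1 - wj * wl / (wm * wk) = -((wj * wl - wm * wk) / (wm * wk)) by field_simp; ring]
      -- Each `1 - x` is expressed by a quantity known to be non-zero; `try` is needed because a
      -- given corner involves only some of the arguments.
      try rw [show 1 - mb * wm / wj = (wj - mb * wm) / wj by field_simp]
      try rw [show 1 - ma * wk / wj = -((ma * wk - wj) / wj) by field_simp; ring]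
      try rw [show 1 - mb * wl / wk = (wk - mb * wl) / wk by field_simp]
      try rw [show 1 - ma * wl / wm = -((ma * wl - wm) / wm) by field_simp; ring]
      field_simp
  · obtain ⟨h1, h2, h3, h4, h5⟩ := nondegenerate_positive hw hm hnd hc
    cases q <;>
    simp only [cornerDeriv, hc, one_mul, if_true,
      sub_eq_add_neg, Complex.exp_add, Complex.exp_neg, hA, hL] <;>
    simp only [logArg, dilogArg, hc, cornerFactor, regionFactor, weight, overStrand, cornerAt,
      if_false, if_true, reduceCtorEq, Matrix.cons_val, ← sub_eq_add_neg]
    all_goals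
      generalize w (D.region c .j) = wj at *
      generalize w (D.region c .k) = wk at *
      generalize w (D.region c .l) = wl at *
      generalize w (D.region c .m) = wm at *
      generalize m (D.component (c, .alpha)) = ma at *
      generalize m (D.component (c, .beta)) = mb at *
      rw [show 1 - wj * wl / (wm * wk) = -((wj * wl - wm * wk) / (wm * wk)) by field_simp; ring]
      try rw [show 1 - wm / (mb * wj) = (mb * wj - wm) / (mb * wj) by field_simp]
      try rw [show 1 - wk / (ma * wj) = -((wk - ma * wj) / (ma * wj)) by field_simp; ring]
      try rw [show 1 - wl / (mb * wk) = (mb * wk - wl) / (mb * wk) by field_simp]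
      try rw [show 1 - wl / (ma * wm) = -((wl - ma * wm) / (ma * wm)) by field_simp; ring]
      field_simp

end OrientedDiagram

/-! ### From products over corners to products over edges -/

open Classical in
/-- A factor which is present only if a condition holds. -/
noncomputable def factorIf (p : Prop) (x : ℂ) : ℂ := if p then x else 1

theorem ite_eq_factorIf (p : Prop) [Decidable p] (x : ℂ) : (if p then x else 1) = factorIf p x := by
  by_cases h : p <;> simp [factorIf, h]

theorem factorIf_mul (p : Prop) (x y : ℂ) :
    factorIf p (x * y) = factorIf p x * factorIf p y := by
  by_cases h : p <;> simp [factorIf, h]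

theorem factorIf_one (p : Prop) : factorIf p 1 = 1 := by simp [factorIf]

theorem factorIf_of_not {p : Prop} (h : ¬p) (x : ℂ) : factorIf p x = 1 := by simp [factorIf, h]

/-- The number `x` at the outgoing half and its inverse at the incoming half. -/
noncomputable def Half.orient : Half → ℂ → ℂ
  | .out, x => x
  | .inc, x => x⁻¹

namespace OrientedDiagram

variable {D : OrientedDiagram} {w : D.Region → ℂ} {m : D.Component → ℂ}

theorem prod_strand {M : Type*} [CommMonoid M] (f : Strand → M) :
    ∏ s, f s = f .alpha * f .beta := by
  rw [show (Finset.univ : Finset Strand) = {.alpha, .beta} from rfl,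
    Finset.prod_pair (by decide)]

/-- A product over the half-strands at all crossings, arranged by edges. -/
theorem prod_halfStrand (F : D.Crossing → Strand → Half → ℂ) :
    ∏ c, (F c .alpha .out * F c .alpha .inc * (F c .beta .out * F c .beta .inc)) =
      ∏ e : D.Edge, F e.1 e.2 .out * F (D.next e).1 (D.next e).2 .inc := by
  rw [Finset.prod_mul_distrib (s := (Finset.univ : Finset D.Edge)),
    Equiv.prod_comp D.next fun e : D.Edge => F e.1 e.2 .inc,
    ← Finset.prod_mul_distrib, Fintype.prod_prod_type]
  simp only [prod_strand]

/-- This is where the critical point equations enter, as branch-free products over the corners of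
each region. -/
theorem prod_cornerFactor (hw : ∀ r, w r ≠ 0) (hm : ∀ i, m i ≠ 0) (hnd : D.IsNondegenerate w m)
    (hsol : D.IsSolution w m) (r : D.Region) :
    ∏ c, (factorIf (D.region c .j = r) (D.cornerFactor w m c .j) *
      factorIf (D.region c .k = r) (D.cornerFactor w m c .k) *
      factorIf (D.region c .l = r) (D.cornerFactor w m c .l) *
      factorIf (D.region c .m = r) (D.cornerFactor w m c .m)) = 1 := by
  obtain ⟨B, hB, hs⟩ := hsol
  rw [← hs r]
  let ε : D.Region → ℂ := fun r' => if r' = r then 1 else 0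
  have hder : D.potentialDeriv B w m r = ∑ c,
      (ε (D.region c .j) * cornerDeriv (B c) w m c .j +
        ε (D.region c .k) * cornerDeriv (B c) w m c .k +
        ε (D.region c .l) * cornerDeriv (B c) w m c .l +
        ε (D.region c .m) * cornerDeriv (B c) w m c .m) / w r := by
    refine HasDerivAt.deriv (HasDerivAt.fun_sum fun c _ => ?_)
    refine hasDerivAt_crossingPotential (hB c).1 (hB c).2 hw hm ?_ fun r' => ?_
    · exact Function.update_eq_self _ _
    · unfold HasLogDerivAt
      by_cases h : r' = r
      · subst h
        simp only [Function.update_self, ε, if_true, one_mul]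
        rw [div_self (hw _)]
        exact hasDerivAt_id _
      · simp only [Function.update_of_ne h, ε, h, if_false, zero_mul, zero_div]
        exact hasDerivAt_const _ _
  rw [hder, Finset.mul_sum, Complex.exp_sum]
  refine Finset.prod_congr rfl fun c _ => ?_
  have hexp : ∀ q, Complex.exp (ε (D.region c q) * cornerDeriv (B c) w m c q) =
      factorIf (D.region c q = r) (D.cornerFactor w m c q) := fun q => by
    by_cases h : D.region c q = r
    · simp [ε, h, factorIf, exp_cornerDeriv (hB c).1 (hB c).2 hw hm hnd]
    · simp [ε, h, factorIf]
  rw [mul_div_cancel₀ _ (hw r), Complex.exp_add, Complex.exp_add, Complex.exp_add]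
  simp only [hexp]

/-- The ratio of the scales of the crossings at the two ends of an edge. -/
noncomputable def edgeRatio (w : D.Region → ℂ) (m : D.Component → ℂ) (e : D.Edge) : ℂ :=
  D.weight w m (D.next e).1 (D.next e).2 .inc / D.weight w m e.1 e.2 .out

theorem edgeRatio_ne_zero (hw : ∀ r, w r ≠ 0) (hm : ∀ i, m i ≠ 0) (hnd : D.IsNondegenerate w m)
    (e : D.Edge) : edgeRatio w m e ≠ 0 :=
  div_ne_zero (weight_ne_zero hw hm hnd _ _ _) (weight_ne_zero hw hm hnd _ _ _)

theorem regionFactor_left_mul (e : D.Edge) :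
    D.regionFactor w m e.1 e.2 .out .left *
      D.regionFactor w m (D.next e).1 (D.next e).2 .inc .left = (edgeRatio w m e)⁻¹ := by
  rw [edgeRatio, inv_div, div_eq_mul_inv]
  rfl

theorem regionFactor_right_mul (hm : ∀ i, m i ≠ 0) (e : D.Edge) :
    D.regionFactor w m e.1 e.2 .out .right *
      D.regionFactor w m (D.next e).1 (D.next e).2 .inc .right = edgeRatio w m e := by
  have h := D.component_next e
  simp only [regionFactor, edgeRatio, h]
  rw [show D.component (e.1, e.2) = D.component e from rfl]
  have := hm (D.component e)
  field_simp

/-- The product of the corner factors in a region, arranged by the edges on its boundary. -/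
theorem prod_edgeRatio (hw : ∀ r, w r ≠ 0) (hm : ∀ i, m i ≠ 0) (hnd : D.IsNondegenerate w m)
    (hsol : D.IsSolution w m) (r : D.Region) :
    ∏ e with D.sideRegion e .left = r, edgeRatio w m e =
      ∏ e with D.sideRegion e .right = r, edgeRatio w m e := by
  have h := prod_cornerFactor hw hm hnd hsol r
  let F : D.Crossing → Strand → Half → ℂ := fun c s h =>
    factorIf (D.region c (cornerAt s h .left) = r) (D.regionFactor w m c s h .left) *
    factorIf (D.region c (cornerAt s h .right) = r) (D.regionFactor w m c s h .right)
  have hF := prod_halfStrand F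
  have hF' : ∏ c, (F c .alpha .out * F c .alpha .inc * (F c .beta .out * F c .beta .inc)) = 1 := by
    rw [← h]
    refine Finset.prod_congr rfl fun c _ => ?_
    simp only [F, cornerAt, cornerFactor, factorIf_mul]
    ring
  rw [hF'] at hF
  -- Both ends of an edge border the same two regions, so their factors combine into `edgeRatio` for
  -- the right region and its inverse for the left one.
  have hE : ∀ e : D.Edge, F e.1 e.2 .out * F (D.next e).1 (D.next e).2 .inc =
      factorIf (D.sideRegion e .left = r) (edgeRatio w m e)⁻¹ *
      factorIf (D.sideRegion e .right = r) (edgeRatio w m e) := fun e => by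
    simp only [F, region_cornerAt_next]
    rw [← regionFactor_left_mul, ← regionFactor_right_mul hm, factorIf_mul, factorIf_mul]
    simp only [sideRegion]
    ring
  simp only [hE, Finset.prod_mul_distrib] at hF
  simp only [Finset.prod_filter, ite_eq_factorIf]
  have hinv : ∀ e : D.Edge, factorIf (D.sideRegion e .left = r) (edgeRatio w m e)⁻¹ =
      (factorIf (D.sideRegion e .left = r) (edgeRatio w m e))⁻¹ := fun e => by
    by_cases h : D.sideRegion e .left = r <;> simp [factorIf, h]
  simp only [hinv, Finset.prod_inv_distrib] at hF
  have hne : ∏ e, factorIf (D.sideRegion e .left = r) (edgeRatio w m e) ≠ 0 :=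
    Finset.prod_ne_zero_iff.mpr fun e _ => by
      by_cases h : D.sideRegion e .left = r <;> simp [factorIf, h, edgeRatio_ne_zero hw hm hnd]
  field_simp at hF
  exact hF

/-! ## The gluing equations -/

open Classical in
/-- The number `x`, unless it vanishes. -/
noncomputable def unlessZero (x : ℂ) : ℂ := if x = 0 then 1 else x

theorem unlessZero_ne_zero (x : ℂ) : unlessZero x ≠ 0 := by
  by_cases h : x = 0 <;> simp [unlessZero, h]

theorem unlessZero_of_ne {x : ℂ} (h : x ≠ 0) : unlessZero x = x := by simp [unlessZero, h]

variable (D w m) in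
/-- The contribution of a side of a half-strand to the product around an edge from the link to
`p`. -/
noncomputable def upperFactor (c : D.Crossing) (s : Strand) (h : Half) : Side → ℂ
  | .left => w (D.region c (cornerAt s h .left)) /
      unlessZero (m (D.component (c, s)) * w (D.region c (cornerAt s h .left)) -
        w (D.region c (cornerAt s h .right)))
  | .right => unlessZero (m (D.component (c, s)) * w (D.region c (cornerAt s h .left)) -
        w (D.region c (cornerAt s h .right))) /
      (m (D.component (c, s)) * w (D.region c (cornerAt s h .right)))

variable (D w m) in
/-- The contribution of a side of a half-strand to the product around an edge from the link to
`q`. -/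
noncomputable def lowerFactor (c : D.Crossing) (s : Strand) (h : Half) : Side → ℂ
  | .left => unlessZero (w (D.region c (cornerAt s h .left)) -
        m (D.component (c, s)) * w (D.region c (cornerAt s h .right))) /
      (m (D.component (c, s)) * w (D.region c (cornerAt s h .left)))
  | .right => w (D.region c (cornerAt s h .right)) /
      unlessZero (w (D.region c (cornerAt s h .left)) -
        m (D.component (c, s)) * w (D.region c (cornerAt s h .right)))

theorem upperFactor_next (e : D.Edge) (d : Side) :
    D.upperFactor w m (D.next e).1 (D.next e).2 .inc d = D.upperFactor w m e.1 e.2 .out d := by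
  have h := D.component_next e
  cases d <;> simp only [upperFactor, region_cornerAt_next, h] <;> rfl

theorem lowerFactor_next (e : D.Edge) (d : Side) :
    D.lowerFactor w m (D.next e).1 (D.next e).2 .inc d = D.lowerFactor w m e.1 e.2 .out d := by
  have h := D.component_next e
  cases d <;> simp only [lowerFactor, region_cornerAt_next, h] <;> rfl

theorem upperFactor_ne_zero (hw : ∀ r, w r ≠ 0) (hm : ∀ i, m i ≠ 0) (c : D.Crossing) (s : Strand)
    (h : Half) (d : Side) : D.upperFactor w m c s h d ≠ 0 := by
  cases d <;> simp [upperFactor, unlessZero_ne_zero, hw, hm]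

theorem lowerFactor_ne_zero (hw : ∀ r, w r ≠ 0) (hm : ∀ i, m i ≠ 0) (c : D.Crossing) (s : Strand)
    (h : Half) (d : Side) : D.lowerFactor w m c s h d ≠ 0 := by
  cases d <;> simp [lowerFactor, unlessZero_ne_zero, hw, hm]

/-- The contribution of a tetrahedron to the product of the cross-ratios around the edges in a
class. -/
noncomputable def tetFactor (χ : Sym2 OctVertex → Prop) (v : Fin 4 → OctVertex) (z : ℂ) : ℂ :=
  factorIf (χ s(v 0, v 1)) z * factorIf (χ s(v 0, v 2)) (1 - 1 / z) *
    factorIf (χ s(v 0, v 3)) (1 / (1 - z)) * factorIf (χ s(v 1, v 2)) (1 / (1 - z)) *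
    factorIf (χ s(v 1, v 3)) (1 - 1 / z) * factorIf (χ s(v 2, v 3)) z

theorem prod_edgeCrossRatio (χ : Sym2 OctVertex → Prop) (v : Fin 4 → OctVertex) (z : ℂ) :
    ∏ a, ∏ b, factorIf (a < b ∧ χ s(v a, v b)) (edgeCrossRatio z a b) = tetFactor χ v z := by
  have h : ∀ a b : Fin 4, ¬a < b → ∀ (p : Prop) (x : ℂ), factorIf (a < b ∧ p) x = 1 :=
    fun a b hab p x => factorIf_of_not (fun h' => hab h'.1) x
  have h' : ∀ a b : Fin 4, a < b → ∀ (p : Prop) (x : ℂ), factorIf (a < b ∧ p) x = factorIf p x :=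
    fun a b hab p x => by simp [hab]
  rw [Fin.prod_univ_four]
  simp only [Fin.prod_univ_four]
  rw [h 0 0, h 1 0, h 1 1, h 2 0, h 2 1, h 2 2, h 3 0, h 3 1, h 3 2, h 3 3, h' 0 1, h' 0 2,
    h' 0 3, h' 1 2, h' 1 3, h' 2 3]
  · simp only [tetFactor, edgeCrossRatio]
    ring
  all_goals decide

/-- The pair of equatorial vertices in a corner. -/
def cornerPair : Corner → Sym2 OctVertex
  | .j => s(.equator .beta .out, .equator .alpha .out)
  | .k => s(.equator .beta .inc, .equator .alpha .out)
  | .l => s(.equator .beta .inc, .equator .alpha .inc)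
  | .m => s(.equator .beta .out, .equator .alpha .inc)

theorem faceVertex_regional (c : D.Crossing) (s : Strand) (h : Half) (d : Side) :
    s(D.faceVertex c s h d 1, D.faceVertex c s h d 2) = cornerPair (cornerAt s h d) := by
  cases hc : D.positive c <;> cases s <;> cases h <;> cases d <;>
    simp [faceVertex, overStrand, hc, cornerAt, cornerPair, otherHalf, Strand.other, Sym2.eq_swap]

variable (D) in
/-- The contribution of a half-strand to the product of the cross-ratios around the edges in a
class, except for the contribution of the regional edges. -/
noncomputable def linkFactor (w : D.Region → ℂ) (m : D.Component → ℂ)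
    (χ : Sym2 OctVertex → Prop) (c : D.Crossing) (s : Strand) (h : Half) : ℂ :=
  factorIf (χ s(D.faceVertex c s h .left 0, D.faceVertex c s h .left 1))
      (h.orient (D.upperFactor w m c s h .left)) *
    factorIf (χ s(D.faceVertex c s h .right 0, D.faceVertex c s h .right 1))
      (h.orient (D.upperFactor w m c s h .right)) *
    factorIf (χ s(D.faceVertex c s h .left 0, D.faceVertex c s h .left 2))
      (h.orient (D.lowerFactor w m c s h .left)) *
    factorIf (χ s(D.faceVertex c s h .right 0, D.faceVertex c s h .right 2))
      (h.orient (D.lowerFactor w m c s h .right))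

/-- The products of the cross-ratios of the tetrahedra at a positive crossing around the edges of
the octahedron. -/
theorem octahedron_products_positive (hw : ∀ r, w r ≠ 0) (hm : ∀ i, m i ≠ 0)
    (hnd : D.IsNondegenerate w m) {c : D.Crossing} (hc : D.positive c = true) :
    Half.orient .out (D.upperFactor w m c .beta .out .left) *
        Half.orient .inc (D.upperFactor w m c .beta .inc .left) =
      (1 / (1 - D.shape w m c 0)) * (1 - 1 / D.shape w m c 1) ∧
    Half.orient .out (D.upperFactor w m c .beta .out .right) *
        Half.orient .inc (D.upperFactor w m c .beta .inc .right) =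
      (1 - 1 / D.shape w m c 0) * (1 / (1 - D.shape w m c 1)) ∧
    Half.orient .out (D.lowerFactor w m c .beta .out .left) *
        Half.orient .out (D.lowerFactor w m c .beta .out .right) =
      D.shape w m c 0 ∧
    Half.orient .inc (D.lowerFactor w m c .beta .inc .left) *
        Half.orient .inc (D.lowerFactor w m c .beta .inc .right) =
      D.shape w m c 1 ∧
    Half.orient .out (D.upperFactor w m c .alpha .out .left) *
        Half.orient .out (D.upperFactor w m c .alpha .out .right) =
      D.shape w m c 2 ∧
    Half.orient .inc (D.upperFactor w m c .alpha .inc .left) *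
        Half.orient .inc (D.upperFactor w m c .alpha .inc .right) =
      D.shape w m c 3 ∧
    Half.orient .out (D.lowerFactor w m c .alpha .out .right) *
        Half.orient .inc (D.lowerFactor w m c .alpha .inc .right) =
      (1 / (1 - D.shape w m c 2)) * (1 - 1 / D.shape w m c 3) ∧
    Half.orient .out (D.lowerFactor w m c .alpha .out .left) *
        Half.orient .inc (D.lowerFactor w m c .alpha .inc .left) =
      (1 - 1 / D.shape w m c 2) * (1 / (1 - D.shape w m c 3)) ∧
    D.cornerFactor w m c .j =
      (1 - 1 / D.shape w m c 0) * (1 - 1 / D.shape w m c 2) * (1 / (1 - D.shape w m c 4)) ∧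
    D.cornerFactor w m c .k =
      (1 / (1 - D.shape w m c 1)) * (1 / (1 - D.shape w m c 2)) * (1 - 1 / D.shape w m c 4) ∧
    D.cornerFactor w m c .l =
      (1 - 1 / D.shape w m c 1) * (1 - 1 / D.shape w m c 3) * (1 / (1 - D.shape w m c 4)) ∧
    D.cornerFactor w m c .m =
      (1 / (1 - D.shape w m c 0)) * (1 / (1 - D.shape w m c 3)) * (1 - 1 / D.shape w m c 4) ∧
    1 =
      D.shape w m c 0 * D.shape w m c 1 * D.shape w m c 4 ∧
    1 =
      D.shape w m c 2 * D.shape w m c 3 * D.shape w m c 4 := by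
  obtain ⟨h1, h2, h3, h4, h5⟩ := nondegenerate_positive hw hm hnd hc
  have hj := hw (D.region c .j)
  have hk := hw (D.region c .k)
  have hl := hw (D.region c .l)
  have hm' := hw (D.region c .m)
  have ha := hm (D.component (c, .alpha))
  have hb := hm (D.component (c, .beta))
  simp only [Half.orient, cornerFactor, regionFactor, weight, upperFactor, lowerFactor, cornerAt,
    overStrand, shape, hc, if_true, reduceCtorEq, if_false, Matrix.cons_val]
  generalize w (D.region c .j) = wj at *
  generalize w (D.region c .k) = wk at *
  generalize w (D.region c .l) = wl at *
  generalize w (D.region c .m) = wm at *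
  generalize m (D.component (c, .alpha)) = ma at *
  generalize m (D.component (c, .beta)) = mb at *
  simp only [unlessZero_of_ne h1, unlessZero_of_ne h2, unlessZero_of_ne h3, unlessZero_of_ne h4]
  -- Non-degeneracy does not control these four differences, which belong to `q` along the
  -- over-strand and to `p` along the under-strand. They cancel between the two sides of a
  -- half-strand, so any non-zero replacement serves.
  have u1 := unlessZero_ne_zero (wj - mb * wm)
  generalize unlessZero (wj - mb * wm) = x1 at *
  have u2 := unlessZero_ne_zero (wk - mb * wl)
  generalize unlessZero (wk - mb * wl) = x2 at *
  have u3 := unlessZero_ne_zero (ma * wk - wj)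
  generalize unlessZero (ma * wk - wj) = x3 at *
  have u4 := unlessZero_ne_zero (ma * wl - wm)
  generalize unlessZero (ma * wl - wm) = x4 at *
  rw [show 1 - wm / (mb * wj) = (mb * wj - wm) / (mb * wj) by field_simp]
  rw [show 1 - mb * wk / wl = -((mb * wk - wl) / wl) by field_simp; ring]
  rw [show 1 - wk / (ma * wj) = -((wk - ma * wj) / (ma * wj)) by field_simp; ring]
  rw [show 1 - ma * wm / wl = (wl - ma * wm) / wl by field_simp]
  rw [show 1 - wj * wl / (wm * wk) = -((wj * wl - wm * wk) / (wm * wk)) by field_simp; ring]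
  rw [show 1 - 1 / (wm / (mb * wj)) = -((mb * wj - wm) / wm) by field_simp; ring]
  rw [show 1 - 1 / (mb * wk / wl) = (mb * wk - wl) / (mb * wk) by field_simp]
  rw [show 1 - 1 / (wk / (ma * wj)) = (wk - ma * wj) / wk by field_simp]
  rw [show 1 - 1 / (ma * wm / wl) = -((wl - ma * wm) / (ma * wm)) by field_simp; ring]
  rw [show 1 - 1 / (wj * wl / (wm * wk)) = (wj * wl - wm * wk) / (wj * wl) by field_simp]
  refine ⟨?_, ?_, ?_, ?_, ?_, ?_, ?_, ?_, ?_, ?_, ?_, ?_, ?_, ?_⟩ <;> field_simp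

theorem prod_tetFactor_positive (hw : ∀ r, w r ≠ 0) (hm : ∀ i, m i ≠ 0)
    (hnd : D.IsNondegenerate w m) (χ : Sym2 OctVertex → Prop) {c : D.Crossing}
    (hc : D.positive c = true) :
    ∏ t, tetFactor χ (D.tetVertex c t) (D.shape w m c t) =
      factorIf (χ (cornerPair .j)) (D.cornerFactor w m c .j) *
      factorIf (χ (cornerPair .k)) (D.cornerFactor w m c .k) *
      factorIf (χ (cornerPair .l)) (D.cornerFactor w m c .l) *
      factorIf (χ (cornerPair .m)) (D.cornerFactor w m c .m) *
      (D.linkFactor w m χ c .alpha .out * D.linkFactor w m χ c .alpha .inc *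
        (D.linkFactor w m χ c .beta .out * D.linkFactor w m χ c .beta .inc)) := by
  have sw1 : s(OctVertex.equator .alpha .out, .equator .beta .out) =
    s(.equator .beta .out, .equator .alpha .out) := Sym2.eq_swap
  have sw2 : s(OctVertex.equator .alpha .out, .equator .beta .inc) =
    s(.equator .beta .inc, .equator .alpha .out) := Sym2.eq_swap
  have sw3 : s(OctVertex.equator .alpha .inc, .equator .beta .out) =
    s(.equator .beta .out, .equator .alpha .inc) := Sym2.eq_swap
  have sw4 : s(OctVertex.equator .alpha .inc, .equator .beta .inc) =
    s(.equator .beta .inc, .equator .alpha .inc) := Sym2.eq_swap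
  have sw5 : s(OctVertex.equator .alpha .inc, .equator .alpha .out) =
    s(.equator .alpha .out, .equator .alpha .inc) := Sym2.eq_swap
  have sw6 : s(OctVertex.equator .beta .inc, .equator .beta .out) =
    s(.equator .beta .out, .equator .beta .inc) := Sym2.eq_swap
  obtain ⟨r1, r2, r3, r4, r5, r6, r7, r8, r9, r10, r11, r12, r13, r14⟩ :=
    octahedron_products_positive hw hm hnd hc
  replace r1 := congrArg (factorIf (χ s(OctVertex.top, .equator .alpha .out))) r1
  replace r2 := congrArg (factorIf (χ s(OctVertex.top, .equator .alpha .inc))) r2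
  replace r3 := congrArg (factorIf (χ s(OctVertex.top, .equator .beta .out))) r3
  replace r4 := congrArg (factorIf (χ s(OctVertex.top, .equator .beta .inc))) r4
  replace r5 := congrArg (factorIf (χ s(OctVertex.bottom, .equator .alpha .out))) r5
  replace r6 := congrArg (factorIf (χ s(OctVertex.bottom, .equator .alpha .inc))) r6
  replace r7 := congrArg (factorIf (χ s(OctVertex.bottom, .equator .beta .out))) r7
  replace r8 := congrArg (factorIf (χ s(OctVertex.bottom, .equator .beta .inc))) r8
  replace r9 := congrArg (factorIf (χ (cornerPair .j))) r9
  replace r10 := congrArg (factorIf (χ (cornerPair .k))) r10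
  replace r11 := congrArg (factorIf (χ (cornerPair .l))) r11
  replace r12 := congrArg (factorIf (χ (cornerPair .m))) r12
  replace r13 := congrArg (factorIf (χ s(OctVertex.equator .alpha .out, .equator .alpha .inc))) r13
  replace r14 := congrArg (factorIf (χ s(OctVertex.equator .beta .out, .equator .beta .inc))) r14
  simp only [factorIf_mul, cornerPair, factorIf_one]
    at r1 r2 r3 r4 r5 r6 r7 r8 r9 r10 r11 r12 r13 r14
  have ho : D.overStrand c = .beta := by simp [overStrand, hc]
  simp only [Fin.prod_univ_five, tetFactor, tetVertex, hc, if_true, ho,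
    underStrand, Strand.other, Matrix.cons_val, cornerPair, linkFactor, faceVertex,
    otherHalf, reduceCtorEq, if_false, sw1, sw2, sw3, sw4, sw5, sw6]
  -- The fourteen identities correspond to the twelve edges of the octahedron and the two diagonals,
  -- each restricted to the edges satisfying `χ`; their product is the claim.
  have key := r1
  replace key := congrArg₂ HMul.hMul key r2
  replace key := congrArg₂ HMul.hMul key r3
  replace key := congrArg₂ HMul.hMul key r4
  replace key := congrArg₂ HMul.hMul key r5
  replace key := congrArg₂ HMul.hMul key r6
  replace key := congrArg₂ HMul.hMul key r7
  replace key := congrArg₂ HMul.hMul key r8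
  replace key := congrArg₂ HMul.hMul key r9
  replace key := congrArg₂ HMul.hMul key r10
  replace key := congrArg₂ HMul.hMul key r11
  replace key := congrArg₂ HMul.hMul key r12
  replace key := congrArg₂ HMul.hMul key r13
  replace key := congrArg₂ HMul.hMul key r14
  linear_combination -key

/-- The products of the cross-ratios of the tetrahedra at a negative crossing around the edges of
the octahedron. -/
theorem octahedron_products_negative (hw : ∀ r, w r ≠ 0) (hm : ∀ i, m i ≠ 0)
    (hnd : D.IsNondegenerate w m) {c : D.Crossing} (hc : D.positive c = false) :
    Half.orient .out (D.upperFactor w m c .alpha .out .left) *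
        Half.orient .inc (D.upperFactor w m c .alpha .inc .left) =
      (1 / (1 - D.shape w m c 0)) * (1 - 1 / D.shape w m c 1) ∧
    Half.orient .out (D.upperFactor w m c .alpha .out .right) *
        Half.orient .inc (D.upperFactor w m c .alpha .inc .right) =
      (1 - 1 / D.shape w m c 0) * (1 / (1 - D.shape w m c 1)) ∧
    Half.orient .out (D.lowerFactor w m c .alpha .out .left) *
        Half.orient .out (D.lowerFactor w m c .alpha .out .right) =
      D.shape w m c 0 ∧
    Half.orient .inc (D.lowerFactor w m c .alpha .inc .left) *
        Half.orient .inc (D.lowerFactor w m c .alpha .inc .right) =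
      D.shape w m c 1 ∧
    Half.orient .out (D.upperFactor w m c .beta .out .left) *
        Half.orient .out (D.upperFactor w m c .beta .out .right) =
      D.shape w m c 2 ∧
    Half.orient .inc (D.upperFactor w m c .beta .inc .left) *
        Half.orient .inc (D.upperFactor w m c .beta .inc .right) =
      D.shape w m c 3 ∧
    Half.orient .out (D.lowerFactor w m c .beta .out .left) *
        Half.orient .inc (D.lowerFactor w m c .beta .inc .left) =
      (1 - 1 / D.shape w m c 2) * (1 / (1 - D.shape w m c 3)) ∧
    Half.orient .out (D.lowerFactor w m c .beta .out .right) *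
        Half.orient .inc (D.lowerFactor w m c .beta .inc .right) =
      (1 / (1 - D.shape w m c 2)) * (1 - 1 / D.shape w m c 3) ∧
    D.cornerFactor w m c .j =
      (1 / (1 - D.shape w m c 0)) * (1 / (1 - D.shape w m c 2)) * (1 - 1 / D.shape w m c 4) ∧
    D.cornerFactor w m c .k =
      (1 - 1 / D.shape w m c 0) * (1 - 1 / D.shape w m c 3) * (1 / (1 - D.shape w m c 4)) ∧
    D.cornerFactor w m c .l =
      (1 / (1 - D.shape w m c 1)) * (1 / (1 - D.shape w m c 3)) * (1 - 1 / D.shape w m c 4) ∧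
    D.cornerFactor w m c .m =
      (1 - 1 / D.shape w m c 1) * (1 - 1 / D.shape w m c 2) * (1 / (1 - D.shape w m c 4)) ∧
    1 =
      D.shape w m c 0 * D.shape w m c 1 * D.shape w m c 4 ∧
    1 =
      D.shape w m c 2 * D.shape w m c 3 * D.shape w m c 4 := by
  obtain ⟨h1, h2, h3, h4, h5⟩ := nondegenerate_negative hw hnd hc
  have hj := hw (D.region c .j)
  have hk := hw (D.region c .k)
  have hl := hw (D.region c .l)
  have hm' := hw (D.region c .m)
  have ha := hm (D.component (c, .alpha))
  have hb := hm (D.component (c, .beta))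
  simp only [Half.orient, cornerFactor, regionFactor, weight, upperFactor, lowerFactor, cornerAt,
    overStrand, shape, hc, Bool.false_eq_true, if_true, reduceCtorEq, if_false, Matrix.cons_val]
  generalize w (D.region c .j) = wj at *
  generalize w (D.region c .k) = wk at *
  generalize w (D.region c .l) = wl at *
  generalize w (D.region c .m) = wm at *
  generalize m (D.component (c, .alpha)) = ma at *
  generalize m (D.component (c, .beta)) = mb at *
  simp only [unlessZero_of_ne h1, unlessZero_of_ne h2, unlessZero_of_ne h3, unlessZero_of_ne h4]
  -- Again the differences that may vanish are those at `q` along the over-strand and at `p` along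
  -- the under-strand.
  have u1 := unlessZero_ne_zero (wk - ma * wj)
  generalize unlessZero (wk - ma * wj) = x1 at *
  have u2 := unlessZero_ne_zero (wl - ma * wm)
  generalize unlessZero (wl - ma * wm) = x2 at *
  have u3 := unlessZero_ne_zero (mb * wj - wm)
  generalize unlessZero (mb * wj - wm) = x3 at *
  have u4 := unlessZero_ne_zero (mb * wk - wl)
  generalize unlessZero (mb * wk - wl) = x4 at *
  rw [show 1 - wj / (ma * wk) = (ma * wk - wj) / (ma * wk) by field_simp]
  rw [show 1 - ma * wl / wm = -((ma * wl - wm) / wm) by field_simp; ring]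
  rw [show 1 - wj / (mb * wm) = -((wj - mb * wm) / (mb * wm)) by field_simp; ring]
  rw [show 1 - mb * wl / wk = (wk - mb * wl) / wk by field_simp]
  rw [show 1 - wk * wm / (wj * wl) = (wj * wl - wm * wk) / (wj * wl) by field_simp]
  rw [show 1 - 1 / (wj / (ma * wk)) = -((ma * wk - wj) / wj) by field_simp; ring]
  rw [show 1 - 1 / (ma * wl / wm) = (ma * wl - wm) / (ma * wl) by field_simp]
  rw [show 1 - 1 / (wj / (mb * wm)) = (wj - mb * wm) / wj by field_simp]
  rw [show 1 - 1 / (mb * wl / wk) = -((wk - mb * wl) / (mb * wl)) by field_simp; ring]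
  rw [show 1 - 1 / (wk * wm / (wj * wl)) = -((wj * wl - wm * wk) / (wk * wm)) by field_simp; ring]
  refine ⟨?_, ?_, ?_, ?_, ?_, ?_, ?_, ?_, ?_, ?_, ?_, ?_, ?_, ?_⟩ <;> field_simp

theorem prod_tetFactor_negative (hw : ∀ r, w r ≠ 0) (hm : ∀ i, m i ≠ 0)
    (hnd : D.IsNondegenerate w m) (χ : Sym2 OctVertex → Prop) {c : D.Crossing}
    (hc : D.positive c = false) :
    ∏ t, tetFactor χ (D.tetVertex c t) (D.shape w m c t) =
      factorIf (χ (cornerPair .j)) (D.cornerFactor w m c .j) *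
      factorIf (χ (cornerPair .k)) (D.cornerFactor w m c .k) *
      factorIf (χ (cornerPair .l)) (D.cornerFactor w m c .l) *
      factorIf (χ (cornerPair .m)) (D.cornerFactor w m c .m) *
      (D.linkFactor w m χ c .alpha .out * D.linkFactor w m χ c .alpha .inc *
        (D.linkFactor w m χ c .beta .out * D.linkFactor w m χ c .beta .inc)) := by
  have sw1 : s(OctVertex.equator .alpha .out, .equator .beta .out) =
    s(.equator .beta .out, .equator .alpha .out) := Sym2.eq_swap
  have sw2 : s(OctVertex.equator .alpha .out, .equator .beta .inc) =
    s(.equator .beta .inc, .equator .alpha .out) := Sym2.eq_swap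
  have sw3 : s(OctVertex.equator .alpha .inc, .equator .beta .out) =
    s(.equator .beta .out, .equator .alpha .inc) := Sym2.eq_swap
  have sw4 : s(OctVertex.equator .alpha .inc, .equator .beta .inc) =
    s(.equator .beta .inc, .equator .alpha .inc) := Sym2.eq_swap
  have sw5 : s(OctVertex.equator .alpha .inc, .equator .alpha .out) =
    s(.equator .alpha .out, .equator .alpha .inc) := Sym2.eq_swap
  have sw6 : s(OctVertex.equator .beta .inc, .equator .beta .out) =
    s(.equator .beta .out, .equator .beta .inc) := Sym2.eq_swap
  obtain ⟨r1, r2, r3, r4, r5, r6, r7, r8, r9, r10, r11, r12, r13, r14⟩ :=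
    octahedron_products_negative hw hm hnd hc
  replace r1 := congrArg (factorIf (χ s(OctVertex.top, .equator .beta .inc))) r1
  replace r2 := congrArg (factorIf (χ s(OctVertex.top, .equator .beta .out))) r2
  replace r3 := congrArg (factorIf (χ s(OctVertex.top, .equator .alpha .out))) r3
  replace r4 := congrArg (factorIf (χ s(OctVertex.top, .equator .alpha .inc))) r4
  replace r5 := congrArg (factorIf (χ s(OctVertex.bottom, .equator .beta .out))) r5
  replace r6 := congrArg (factorIf (χ s(OctVertex.bottom, .equator .beta .inc))) r6
  replace r7 := congrArg (factorIf (χ s(OctVertex.bottom, .equator .alpha .out))) r7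
  replace r8 := congrArg (factorIf (χ s(OctVertex.bottom, .equator .alpha .inc))) r8
  replace r9 := congrArg (factorIf (χ (cornerPair .j))) r9
  replace r10 := congrArg (factorIf (χ (cornerPair .k))) r10
  replace r11 := congrArg (factorIf (χ (cornerPair .l))) r11
  replace r12 := congrArg (factorIf (χ (cornerPair .m))) r12
  replace r13 := congrArg (factorIf (χ s(OctVertex.equator .beta .out, .equator .beta .inc))) r13
  replace r14 := congrArg (factorIf (χ s(OctVertex.equator .alpha .out, .equator .alpha .inc))) r14
  simp only [factorIf_mul, cornerPair, factorIf_one]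
    at r1 r2 r3 r4 r5 r6 r7 r8 r9 r10 r11 r12 r13 r14
  have ho : D.overStrand c = .alpha := by simp [overStrand, hc]
  simp only [Fin.prod_univ_five, tetFactor, tetVertex, hc, if_true, ho,
    underStrand, Strand.other, Matrix.cons_val, cornerPair, linkFactor, faceVertex,
    otherHalf, reduceCtorEq, if_false, sw1, sw2, sw3, sw4, sw5, sw6, Bool.false_eq_true]
  have key := r1
  replace key := congrArg₂ HMul.hMul key r2
  replace key := congrArg₂ HMul.hMul key r3
  replace key := congrArg₂ HMul.hMul key r4
  replace key := congrArg₂ HMul.hMul key r5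
  replace key := congrArg₂ HMul.hMul key r6
  replace key := congrArg₂ HMul.hMul key r7
  replace key := congrArg₂ HMul.hMul key r8
  replace key := congrArg₂ HMul.hMul key r9
  replace key := congrArg₂ HMul.hMul key r10
  replace key := congrArg₂ HMul.hMul key r11
  replace key := congrArg₂ HMul.hMul key r12
  replace key := congrArg₂ HMul.hMul key r13
  replace key := congrArg₂ HMul.hMul key r14
  linear_combination -key

end OrientedDiagram

/-! ### Edge classes of the triangulation and proof of the gluing equations -/

namespace OrientedDiagram

variable {D : OrientedDiagram} {w : D.Region → ℂ} {m : D.Component → ℂ}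

theorem cornerPair_injective : Function.Injective cornerPair := by
  intro q q' h
  cases q <;> cases q' <;> first | rfl | (exfalso; revert h; simp [cornerPair])

theorem link_notMem_cornerPair (c : D.Crossing) (s : Strand) (h : Half) (d : Side) (q : Corner) :
    D.faceVertex c s h d 0 ∉ cornerPair q := by
  unfold faceVertex
  split_ifs <;> cases q <;> simp [cornerPair]

/-- The regions in whose corners a pair of vertices lies. -/
def pairRegions (D : OrientedDiagram) (x : D.Crossing × Sym2 OctVertex) : Set D.Region :=
  {r | ∃ q, x.2 = cornerPair q ∧ D.region x.1 q = r}

theorem pairRegions_cornerPair (c : D.Crossing) (q : Corner) :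
    D.pairRegions (c, cornerPair q) = {D.region c q} := by
  ext r
  constructor
  · rintro ⟨q', h, rfl⟩
    rw [Set.mem_singleton_iff, cornerPair_injective h]
  · rintro rfl
    exact ⟨q, rfl, rfl⟩

theorem pairRegions_of_mem_zero {c : D.Crossing} {s : Strand} {h : Half} {d : Side}
    {p : Sym2 OctVertex} (hp : D.faceVertex c s h d 0 ∈ p) : D.pairRegions (c, p) = ∅ := by
  ext r
  simp only [Set.mem_empty_iff_false, iff_false]
  rintro ⟨q, rfl, -⟩
  exact link_notMem_cornerPair c s h d q hp

/-- This makes `pairRegions` an invariant of edge classes. Gluing preserves the order link, `p`,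
`q`, so regional edges are glued only to regional edges of the same region. -/
theorem pairRegions_glue {x y : D.Crossing × Sym2 OctVertex} (h : D.EdgeGlue x y) :
    D.pairRegions x = D.pairRegions y := by
  obtain ⟨e, d, a, b, hab⟩ := h
  have h12 : D.pairRegions (e.1, s(D.faceVertex e.1 e.2 .out d 1, D.faceVertex e.1 e.2 .out d 2)) =
      D.pairRegions ((D.next e).1, s(D.faceVertex (D.next e).1 (D.next e).2 .inc d 1,
        D.faceVertex (D.next e).1 (D.next e).2 .inc d 2)) := by
    rw [faceVertex_regional, faceVertex_regional, pairRegions_cornerPair, pairRegions_cornerPair,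
      region_cornerAt_next]
    rfl
  by_cases ha : a = 0
  · subst ha
    rw [pairRegions_of_mem_zero (Sym2.mem_mk_left _ _),
      pairRegions_of_mem_zero (Sym2.mem_mk_left _ _)]
  by_cases hb : b = 0
  · subst hb
    rw [pairRegions_of_mem_zero (Sym2.mem_mk_right _ _),
      pairRegions_of_mem_zero (Sym2.mem_mk_right _ _)]
  have : a = 1 ∧ b = 2 ∨ a = 2 ∧ b = 1 := by omega
  rcases this with ⟨rfl, rfl⟩ | ⟨rfl, rfl⟩
  · exact h12
  · rwa [Sym2.eq_swap, Sym2.eq_swap (a := D.faceVertex (D.next e).1 (D.next e).2 .inc d 2)]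

/-- The class of a pair of vertices of the octahedron at a crossing. -/
def pairClass (D : OrientedDiagram) (c : D.Crossing) (p : Sym2 OctVertex) : D.IdealEdge :=
  Quot.mk _ (c, p)

/-- Regional edges correspond to regions: gluing along faces realizes corner adjacency, and
`pairRegions` separates different regions. -/
theorem pairClass_cornerPair_eq_iff {c c' : D.Crossing} {q q' : Corner} :
    D.pairClass c (cornerPair q) = D.pairClass c' (cornerPair q') ↔
      D.region c q = D.region c' q' := by
  constructor
  · intro h
    have := congrArg (Quot.lift D.pairRegions fun _ _ => pairRegions_glue) h
    simp only [pairClass, pairRegions_cornerPair, Set.singleton_eq_singleton_iff] at this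
    exact this
  · intro h
    refine congrArg (Quot.lift (fun x : D.Crossing × Corner => D.pairClass x.1 (cornerPair x.2))
      ?_) h
    rintro _ _ ⟨e, d⟩
    simp only
    rw [← faceVertex_regional, ← faceVertex_regional]
    exact Quot.sound (EdgeGlue.glue e d 1 2 (by decide))

theorem pairClass_next (e : D.Edge) (d : Side) (a b : Fin 3) (hab : a ≠ b) :
    D.pairClass (D.next e).1 s(D.faceVertex (D.next e).1 (D.next e).2 .inc d a,
        D.faceVertex (D.next e).1 (D.next e).2 .inc d b) =
      D.pairClass e.1 s(D.faceVertex e.1 e.2 .out d a, D.faceVertex e.1 e.2 .out d b) :=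
  (Quot.sound (EdgeGlue.glue e d a b hab)).symm

/-- The factors depend only on the regions beside the edge and on its component, and they enter
inverted at the incoming end. Hence they cancel in every class, whichever link edges are identified
with each other. -/
theorem linkFactor_mul_next (hw : ∀ r, w r ≠ 0) (hm : ∀ i, m i ≠ 0) (E : D.IdealEdge)
    (e : D.Edge) : D.linkFactor w m (fun p => D.pairClass e.1 p = E) e.1 e.2 .out *
      D.linkFactor w m (fun p => D.pairClass (D.next e).1 p = E) (D.next e).1 (D.next e).2 .inc =
        1 := by
  have h1 := pairClass_next e .left 0 1 (by decide)
  have h2 := pairClass_next e .right 0 1 (by decide)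
  have h3 := pairClass_next e .left 0 2 (by decide)
  have h4 := pairClass_next e .right 0 2 (by decide)
  have key : ∀ (p : Prop) (x : ℂ), x ≠ 0 → factorIf p x * factorIf p x⁻¹ = 1 := fun p x hx => by
    rw [← factorIf_mul, mul_inv_cancel₀ hx, factorIf_one]
  have u : ∀ d p, factorIf p (D.upperFactor w m e.1 e.2 .out d) *
      factorIf p (D.upperFactor w m e.1 e.2 .out d)⁻¹ = 1 :=
    fun d p => key p _ (upperFactor_ne_zero hw hm _ _ _ _)
  have l : ∀ d p, factorIf p (D.lowerFactor w m e.1 e.2 .out d) *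
      factorIf p (D.lowerFactor w m e.1 e.2 .out d)⁻¹ = 1 :=
    fun d p => key p _ (lowerFactor_ne_zero hw hm _ _ _ _)
  simp only [linkFactor, h1, h2, h3, h4, upperFactor_next, lowerFactor_next, Half.orient]
  rw [show ∀ a b c d a' b' c' d' : ℂ, a * b * c * d * (a' * b' * c' * d') =
    (a * a') * (b * b') * ((c * c') * (d * d')) from fun _ _ _ _ _ _ _ _ => by ring]
  rw [u, u, l, l]
  norm_num

theorem gluingEquations (hw : ∀ r, w r ≠ 0) (hm : ∀ i, m i ≠ 0) (hnd : D.IsNondegenerate w m)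
    (hsol : D.IsSolution w m) : D.GluingEquations w m := by
  intro E
  have h : ∀ c, ∏ t, tetFactor (fun p => D.pairClass c p = E) (D.tetVertex c t)
      (D.shape w m c t) = _ := fun c => by
    cases hc : D.positive c
    · exact prod_tetFactor_negative hw hm hnd (fun p => D.pairClass c p = E) hc
    · exact prod_tetFactor_positive hw hm hnd (fun p => D.pairClass c p = E) hc
  rw [Finset.prod_filter]
  simp only [ite_eq_factorIf, Fintype.prod_prod_type]
  have h' : ∀ c, ∏ t, ∏ a, ∏ b, factorIf (a < b ∧ D.idealEdge c t a b = E)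
      (edgeCrossRatio (D.shape w m c t) a b) = _ := fun c =>
    (Finset.prod_congr rfl fun t _ => prod_edgeCrossRatio (fun p => D.pairClass c p = E)
      (D.tetVertex c t) (D.shape w m c t)).trans (h c)
  simp only [h']
  rw [Finset.prod_mul_distrib, prod_halfStrand fun c s h =>
    D.linkFactor w m (fun p => D.pairClass c p = E) c s h,
    Finset.prod_congr rfl fun e _ => linkFactor_mul_next hw hm E e, Finset.prod_const_one, mul_one]
  -- Only the corner products are left; they are non-trivial only when the class is that of a
  -- regional edge.
  by_cases hE : ∃ c q, D.pairClass c (cornerPair q) = E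
  · obtain ⟨c₀, q₀, rfl⟩ := hE
    simp only [pairClass_cornerPair_eq_iff]
    exact prod_cornerFactor hw hm hnd hsol _
  · push Not at hE
    exact Finset.prod_eq_one fun c _ => by simp [factorIf_of_not (hE c _)]

end OrientedDiagram

namespace OrientedDiagram

/-! ## The holonomy representation -/

/-- The affine coordinates at the vertex `∞` of the developed triangulation: the crossings have
scales, the edges have relative scales, and the regions have positions. -/
structure Coloring (D : OrientedDiagram) (w : D.Region → ℂ) (m : D.Component → ℂ) where
  scale : D.Crossing → ℂ
  edgeScale : D.Edge → ℂ
  pos : D.Region → ℂ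
  scale_ne_zero : ∀ c, scale c ≠ 0
  edgeScale_ne_zero : ∀ e, edgeScale e ≠ 0
  weight_eq : ∀ c s h, D.weight w m c s h = edgeScale (D.edgeAt c s h) * scale c
  pos_sub : ∀ e, pos (D.sideRegion e .left) - pos (D.sideRegion e .right) =
    edgeScale e * (1 / (m (D.component e) * w (D.sideRegion e .right)) -
      1 / w (D.sideRegion e .left))

variable {D : OrientedDiagram} {w : D.Region → ℂ} {m : D.Component → ℂ}

theorem inEdge_next (e : D.Edge) : D.inEdge (D.next e).1 (D.next e).2 = e := by
  simp [inEdge]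

theorem exists_coloring (hD : D.IsConnected) (hS : D.IsSpherical) (hw : ∀ r, w r ≠ 0)
    (hm : ∀ i, m i ≠ 0) (hnd : D.IsNondegenerate w m) (hsol : D.IsSolution w m) :
    Nonempty (Coloring D w m) := by
  obtain ⟨s, hs, hss⟩ := exists_crossing_scale hD hS (edgeRatio w m)
    (edgeRatio_ne_zero hw hm hnd) (prod_edgeRatio hw hm hnd hsol)
  -- The edge scale is forced by the weight at the outgoing end; the cochain equation for `s` makes
  -- it agree with the weight at the incoming end.
  let κ : D.Edge → ℂ := fun e => D.weight w m e.1 e.2 .out / s e.1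
  have hκ : ∀ c st h, D.weight w m c st h = κ (D.edgeAt c st h) * s c := by
    intro c st h
    cases h
    · simp only [κ, edgeAt]
      rw [div_mul_cancel₀ _ (hs c)]
    · have := hss (D.inEdge c st)
      rw [edgeRatio, next_inEdge] at this
      simp only [κ, edgeAt]
      rw [this]
      have h1 := weight_ne_zero hw hm hnd (D.inEdge c st).1 (D.inEdge c st).2 .out
      have h2 := hs (D.inEdge c st).1
      field_simp
  have hf : ∀ c st h, (1 / (m (D.component (D.edgeAt c st h)) *
        w (D.sideRegion (D.edgeAt c st h) .right)) - 1 / w (D.sideRegion (D.edgeAt c st h) .left)) =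
      1 / (m (D.component (c, st)) * w (D.region c (cornerAt st h .right))) -
        1 / w (D.region c (cornerAt st h .left)) := fun c st h => by
    rw [component_edgeAt, region_cornerAt, region_cornerAt]
  have hκ' : ∀ c st h, κ (D.edgeAt c st h) = D.weight w m c st h / s c := fun c st h => by
    rw [hκ, mul_div_cancel_right₀ _ (hs c)]
  -- All edge scales at a crossing are weights divided by the same `s c`, so closedness there
  -- reduces to a rational identity in the four region variables and the two component variables.
  obtain ⟨Q, hQ⟩ := exists_region_potential hD hS (fun e => κ e *
      (1 / (m (D.component e) * w (D.sideRegion e .right)) - 1 / w (D.sideRegion e .left))) (by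
    intro c
    clear_value κ
    clear hss hsol
    have h1 := fun st => hf c st .inc
    have h2 := fun st => hf c st .out
    have h3 := fun st => hκ' c st .inc
    have h4 := fun st => hκ' c st .out
    simp only [edgeAt] at h1 h2 h3 h4
    simp only [h1, h2, h3, h4]
    have hc0 := hs c
    have hj := hw (D.region c .j)
    have hk := hw (D.region c .k)
    have hl := hw (D.region c .l)
    have hm' := hw (D.region c .m)
    have ha := hm (D.component (c, .alpha))
    have hb := hm (D.component (c, .beta))
    cases hc : D.positive c
    · obtain ⟨n1, n2, n3, n4, n5⟩ := nondegenerate_negative hw hnd hc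
      simp only [weight, cornerAt, overStrand, hc, Bool.false_eq_true, if_false, if_true,
        reduceCtorEq]
      generalize w (D.region c .j) = wj at *
      generalize w (D.region c .k) = wk at *
      generalize w (D.region c .l) = wl at *
      generalize w (D.region c .m) = wm at *
      generalize m (D.component (c, .alpha)) = ma at *
      generalize m (D.component (c, .beta)) = mb at *
      generalize s c = t at *
      have n3' : wj - wm * mb ≠ 0 := by rwa [mul_comm wm]
      have n4' : wk - wl * mb ≠ 0 := by rwa [mul_comm wl]
      field_simp
      ring
    · obtain ⟨n1, n2, n3, n4, n5⟩ := nondegenerate_positive hw hm hnd hc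
      simp only [weight, cornerAt, overStrand, hc, if_false, if_true, reduceCtorEq]
      generalize w (D.region c .j) = wj at *
      generalize w (D.region c .k) = wk at *
      generalize w (D.region c .l) = wl at *
      generalize w (D.region c .m) = wm at *
      generalize m (D.component (c, .alpha)) = ma at *
      generalize m (D.component (c, .beta)) = mb at *
      generalize s c = t at *
      have n3' : wk - wj * ma ≠ 0 := by rwa [mul_comm wj]
      have n4' : wl - wm * ma ≠ 0 := by rwa [mul_comm wm]
      field_simp
      ring)
  exact ⟨⟨s, κ, Q, hs, fun e => div_ne_zero (weight_ne_zero hw hm hnd _ _ _) (hs _), hκ, hQ⟩⟩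

/-! ### The matrices of the edges -/

namespace Coloring

variable (R : Coloring D w m)

/-- The position of the vertex on the link next to an edge. -/
noncomputable def linkPos (e : D.Edge) : ℂ :=
  R.pos (D.sideRegion e .left) + R.edgeScale e / w (D.sideRegion e .left)

/-- The lower left entry of the matrix of an edge. -/
noncomputable def entry (e : D.Edge) : ℂ :=
  (m (D.component e) * w (D.sideRegion e .left) - w (D.sideRegion e .right)) / R.edgeScale e

/-- The vector of the vertex on the link next to an edge. -/
noncomputable def linkVec (e : D.Edge) : Fin 2 → ℂ := ![R.linkPos e, 1]

/-- The vector of the vertex at `q` below a region. -/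
noncomputable def regionVec (r : D.Region) : Fin 2 → ℂ := ![w r * R.pos r, w r]

/-- The matrix with eigenvalue `μ` at `(V, 1)`, with lower left entry `c` and determinant one. -/
noncomputable def eigenMatrix (μ : ℂ) (hμ : μ ≠ 0) (c V : ℂ) :
    Matrix.SpecialLinearGroup (Fin 2) ℂ :=
  ⟨!![μ⁻¹ + c * V, μ * V - (μ⁻¹ + c * V) * V; c, μ - c * V], by
    rw [Matrix.det_fin_two_of]
    field_simp
    ring⟩

/-- The holonomy of the Wirtinger generator of an edge. -/
noncomputable def holonomy (hm : ∀ i, m i ≠ 0) (e : D.Edge) : Matrix.SpecialLinearGroup (Fin 2) ℂ :=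
  eigenMatrix (m (D.component e)) (hm _) (R.entry e) (R.linkPos e)

variable {R}

theorem trace_holonomy (hm : ∀ i, m i ≠ 0) (e : D.Edge) :
    (R.holonomy hm e).1.trace = m (D.component e) + (m (D.component e))⁻¹ := by
  simp [holonomy, eigenMatrix, Matrix.trace_fin_two]
  ring

theorem holonomy_linkVec (hm : ∀ i, m i ≠ 0) (e : D.Edge) :
    (R.holonomy hm e).1.mulVec (R.linkVec e) = m (D.component e) • R.linkVec e := by
  ext i
  fin_cases i <;>
    simp [holonomy, eigenMatrix, linkVec, Matrix.mulVec, dotProduct, Fin.sum_univ_two]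

theorem wedge_linkVec_left (hw : ∀ r, w r ≠ 0) (e : D.Edge) :
    wedge (R.linkVec e) (R.regionVec (D.sideRegion e .left)) = R.edgeScale e := by
  have := hw (D.sideRegion e .left)
  simp [wedge, linkVec, regionVec, linkPos]
  field_simp
  ring

/-- The equation for `pos` says precisely that the link vertex computed from the right region is
`pos r + edgeScale e / (m * w r)`. -/
theorem wedge_linkVec_right (hw : ∀ r, w r ≠ 0) (hm : ∀ i, m i ≠ 0) (e : D.Edge) :
    wedge (R.linkVec e) (R.regionVec (D.sideRegion e .right)) =
      R.edgeScale e / m (D.component e) := by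
  have h1 := hw (D.sideRegion e .left)
  have h2 := hw (D.sideRegion e .right)
  have h3 := hm (D.component e)
  have h := R.pos_sub e
  rw [sub_eq_iff_eq_add] at h
  simp only [wedge, linkVec, regionVec, linkPos, h, Matrix.cons_val_zero, Matrix.cons_val_one]
  field_simp
  ring

/-- The definition of `entry` gives the second coordinate. For the first, the link vector is an
eigenvector, so its determinant with the image is the old one divided by `m`, as on the right side
of the edge. -/
theorem holonomy_regionVec (hw : ∀ r, w r ≠ 0) (hm : ∀ i, m i ≠ 0) (e : D.Edge) :
    (R.holonomy hm e).1.mulVec (R.regionVec (D.sideRegion e .left)) =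
      R.regionVec (D.sideRegion e .right) := by
  have hl := wedge_linkVec_left (R := R) hw e
  have hr := wedge_linkVec_right (R := R) hw hm e
  have h3 := hm (D.component e)
  have h4 := R.edgeScale_ne_zero e
  have hc : R.entry e * R.edgeScale e =
      m (D.component e) * w (D.sideRegion e .left) - w (D.sideRegion e .right) :=
    div_mul_cancel₀ _ h4
  simp only [wedge, linkVec, regionVec, Matrix.cons_val_zero, Matrix.cons_val_one] at hl hr
  rw [eq_div_iff h3] at hr
  ext i
  fin_cases i
  · simp [holonomy, eigenMatrix, regionVec, Matrix.mulVec, dotProduct, Fin.sum_univ_two]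
    field_simp
    linear_combination hr - hl - m (D.component e) * R.linkPos e * hc -
      m (D.component e) * R.linkPos e * R.entry e * hl
  · simp [holonomy, eigenMatrix, regionVec, Matrix.mulVec, dotProduct, Fin.sum_univ_two]
    linear_combination -hc - R.entry e * hl

end Coloring

end OrientedDiagram

/-! ### The Wirtinger relations -/

namespace OrientedDiagram

variable {D : OrientedDiagram} {w : D.Region → ℂ} {m : D.Component → ℂ}

/-- The half of the under-strand which lies to the left of the over-strand. -/
def leftHalf (D : OrientedDiagram) (c : D.Crossing) : Half := if D.positive c then .out else .inc

/-- The half of the under-strand which lies to the right of the over-strand. -/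
def rightHalf (D : OrientedDiagram) (c : D.Crossing) : Half := if D.positive c then .inc else .out

theorem weight_over (c : D.Crossing) (h : Half) : D.weight w m c (D.overStrand c) h =
    m (D.component (c, D.overStrand c)) * w (D.region c (cornerAt (D.overStrand c) h .left)) -
      w (D.region c (cornerAt (D.overStrand c) h .right)) := by
  simp [weight]

theorem under_sub_ne_zero (hw : ∀ r, w r ≠ 0) (hm : ∀ i, m i ≠ 0) (hnd : D.IsNondegenerate w m)
    (c : D.Crossing) (h : Half) :
    w (D.region c (cornerAt (D.underStrand c) h .left)) -
      m (D.component (c, D.underStrand c)) *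
        w (D.region c (cornerAt (D.underStrand c) h .right)) ≠ 0 := by
  cases hc : D.positive c
  · obtain ⟨h1, h2, h3, h4, h5⟩ := nondegenerate_negative hw hnd hc
    cases h <;> simp only [underStrand, overStrand, hc, Strand.other, cornerAt, Bool.false_eq_true,
      if_false] <;> assumption
  · obtain ⟨h1, h2, h3, h4, h5⟩ := nondegenerate_positive hw hm hnd hc
    cases h <;> simp only [underStrand, overStrand, hc, Strand.other, cornerAt, if_true] <;>
      assumption

namespace Coloring

variable {R : Coloring D w m}

/-- The over-strand weight is the numerator of `entry`, so dividing it by the edge scale leaves the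
crossing scale at both halves. -/
theorem entry_over (c : D.Crossing) (h : Half) :
    R.entry (D.edgeAt c (D.overStrand c) h) = R.scale c := by
  have h1 := R.weight_eq c (D.overStrand c) h
  rw [weight_over, region_cornerAt, region_cornerAt,
    ← D.component_edgeAt c (D.overStrand c) h] at h1
  rw [entry, h1, mul_div_cancel_left₀ _ (R.edgeScale_ne_zero _)]

theorem linkPos_over (hw : ∀ r, w r ≠ 0) (hm : ∀ i, m i ≠ 0) (hnd : D.IsNondegenerate w m)
    (c : D.Crossing) : R.linkPos (D.inEdge c (D.overStrand c)) = R.linkPos (c, D.overStrand c) := by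
  have hs := R.scale_ne_zero c
  have hκ : ∀ s h, R.edgeScale (D.edgeAt c s h) = D.weight w m c s h / R.scale c := fun s h => by
    rw [R.weight_eq, mul_div_cancel_right₀ _ hs]
  have hj := hw (D.region c .j)
  have hk := hw (D.region c .k)
  have hl := hw (D.region c .l)
  have hm' := hw (D.region c .m)
  have ha := hm (D.component (c, .alpha))
  have hb := hm (D.component (c, .beta))
  have h1 := fun s => hκ s .inc
  have h2 := fun s => hκ s .out
  have r1 := fun s d => (D.region_cornerAt c s .inc d).symm
  have r2 := fun s d => (D.region_cornerAt c s .out d).symm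
  have c1 := fun s => D.component_edgeAt c s .inc
  simp only [edgeAt] at h1 h2 r1 r2 c1
  cases hc : D.positive c
  · have hpos := R.pos_sub (D.edgeAt c .beta .inc)
    have ho : D.overStrand c = .alpha := by simp [overStrand, hc]
    obtain ⟨n1, n2, n3, n4, n5⟩ := nondegenerate_negative hw hnd hc
    simp only [ho, linkPos, edgeAt, h1, h2, r1, r2, c1, weight, cornerAt, if_true, reduceCtorEq,
      if_false] at hpos ⊢
    rw [sub_eq_iff_eq_add] at hpos
    rw [hpos]
    generalize w (D.region c .j) = wj at *
    generalize w (D.region c .k) = wk at *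
    generalize w (D.region c .l) = wl at *
    generalize w (D.region c .m) = wm at *
    generalize m (D.component (c, .alpha)) = ma at *
    generalize m (D.component (c, .beta)) = mb at *
    generalize R.scale c = t at *
    have n4' : wk - wl * mb ≠ 0 := by rwa [mul_comm wl]
    field_simp
    ring
  · have hpos := R.pos_sub (D.edgeAt c .alpha .out)
    have ho : D.overStrand c = .beta := by simp [overStrand, hc]
    obtain ⟨n1, n2, n3, n4, n5⟩ := nondegenerate_positive hw hm hnd hc
    simp only [ho, linkPos, edgeAt, h1, h2, r1, r2, weight, cornerAt, if_true, reduceCtorEq,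
      if_false] at hpos ⊢
    rw [sub_eq_iff_eq_add] at hpos
    rw [hpos]
    generalize w (D.region c .j) = wj at *
    generalize w (D.region c .k) = wk at *
    generalize w (D.region c .l) = wl at *
    generalize w (D.region c .m) = wm at *
    generalize m (D.component (c, .alpha)) = ma at *
    generalize m (D.component (c, .beta)) = mb at *
    generalize R.scale c = t at *
    have n3' : wk - wj * ma ≠ 0 := by rwa [mul_comm wj]
    field_simp
    ring

theorem holonomy_over (hw : ∀ r, w r ≠ 0) (hm : ∀ i, m i ≠ 0) (hnd : D.IsNondegenerate w m)
    (c : D.Crossing) :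
    R.holonomy hm (D.inEdge c (D.overStrand c)) = R.holonomy hm (c, D.overStrand c) := by
  have h1 := R.entry_over c .inc
  have h2 := R.entry_over c .out
  have h3 := D.component_edgeAt c (D.overStrand c) .inc
  simp only [edgeAt] at h1 h2 h3
  simp only [holonomy, h1, h2, h3, linkPos_over hw hm hnd]

theorem holonomy_over_regionVec (hw : ∀ r, w r ≠ 0) (hm : ∀ i, m i ≠ 0)
    (hnd : D.IsNondegenerate w m) (c : D.Crossing) (h : Half) :
    (R.holonomy hm (c, D.overStrand c)).1.mulVec
        (R.regionVec (D.region c (cornerAt (D.overStrand c) h .left))) =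
      R.regionVec (D.region c (cornerAt (D.overStrand c) h .right)) := by
  have := holonomy_regionVec (R := R) hw hm (D.edgeAt c (D.overStrand c) h)
  rw [region_cornerAt, region_cornerAt, ← this]
  cases h
  · rfl
  · rw [edgeAt, holonomy_over hw hm hnd]

/-- If `A` has eigenvalues `m` and `m⁻¹`, then `m • A u - u` lies in the `m`-eigenline; the link
vertex is thus recovered from the two region vectors. -/
theorem regionVec_comb (hw : ∀ r, w r ≠ 0) (hm : ∀ i, m i ≠ 0) (e : D.Edge) :
    m (D.component e) • R.regionVec (D.sideRegion e .right) - R.regionVec (D.sideRegion e .left) =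
      -(w (D.sideRegion e .left) - m (D.component e) * w (D.sideRegion e .right)) •
        R.linkVec e := by
  have hl := wedge_linkVec_left (R := R) hw e
  have hr := wedge_linkVec_right (R := R) hw hm e
  have h3 := hm (D.component e)
  simp only [wedge, linkVec, regionVec, Matrix.cons_val_zero, Matrix.cons_val_one] at hl hr
  rw [eq_div_iff h3] at hr
  ext i
  fin_cases i
  · simp [regionVec, linkVec]
    linear_combination hl - hr
  · simp [regionVec, linkVec]

/-- This turns non-degeneracy at an under-strand into independence of the two region vectors beside
it. -/
theorem wedge_regionVec (hw : ∀ r, w r ≠ 0) (hm : ∀ i, m i ≠ 0) (e : D.Edge) :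
    m (D.component e) * wedge (R.regionVec (D.sideRegion e .left))
        (R.regionVec (D.sideRegion e .right)) =
      R.edgeScale e *
        (w (D.sideRegion e .left) - m (D.component e) * w (D.sideRegion e .right)) := by
  have hl := wedge_linkVec_left (R := R) hw e
  have hr := wedge_linkVec_right (R := R) hw hm e
  have h3 := hm (D.component e)
  simp only [wedge, linkVec, regionVec, Matrix.cons_val_zero, Matrix.cons_val_one] at hl hr ⊢
  rw [eq_div_iff h3] at hr
  linear_combination w (D.sideRegion e .left) * hr -
    m (D.component e) * w (D.sideRegion e .right) * hl

/-- The holonomy of the over-strand carries the left half of the under-strand to the right half. -/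
theorem conj_of_edges (hw : ∀ r, w r ≠ 0) (hm : ∀ i, m i ≠ 0)
    {C : Matrix.SpecialLinearGroup (Fin 2) ℂ} {e e' : D.Edge}
    (hcomp : D.component e = D.component e')
    (he : w (D.sideRegion e .left) - m (D.component e) * w (D.sideRegion e .right) ≠ 0)
    (he' : w (D.sideRegion e' .left) - m (D.component e') * w (D.sideRegion e' .right) ≠ 0)
    (hl : C.1.mulVec (R.regionVec (D.sideRegion e .left)) = R.regionVec (D.sideRegion e' .left))
    (hr : C.1.mulVec (R.regionVec (D.sideRegion e .right)) =
      R.regionVec (D.sideRegion e' .right)) :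
    C * R.holonomy hm e = R.holonomy hm e' * C ∧
      toPoint (C.1.mulVec (R.linkVec e)) = toPoint (R.linkVec e') := by
  constructor
  · refine mul_eq_mul_of_trace (fun h => ?_) (holonomy_regionVec hw hm e)
      (holonomy_regionVec hw hm e') hl hr ?_
    · have := wedge_regionVec (R := R) hw hm e
      rw [h, mul_zero, eq_comm] at this
      exact mul_ne_zero (R.edgeScale_ne_zero e) he this
    · rw [trace_holonomy, trace_holonomy, hcomp]
  · have h1 := regionVec_comb (R := R) hw hm e
    have h2 := regionVec_comb (R := R) hw hm e'
    rw [← toPoint_smul (neg_ne_zero.mpr he), ← Matrix.mulVec_smul, ← h1, Matrix.mulVec_sub,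
      Matrix.mulVec_smul, hl, hr, hcomp, h2, toPoint_smul (neg_ne_zero.mpr he')]

theorem conj_under (hw : ∀ r, w r ≠ 0) (hm : ∀ i, m i ≠ 0) (hnd : D.IsNondegenerate w m)
    (c : D.Crossing) :
    R.holonomy hm (c, D.overStrand c) *
        R.holonomy hm (D.edgeAt c (D.underStrand c) (D.leftHalf c)) =
      R.holonomy hm (D.edgeAt c (D.underStrand c) (D.rightHalf c)) *
        R.holonomy hm (c, D.overStrand c) ∧
    toPoint ((R.holonomy hm (c, D.overStrand c)).1.mulVec
        (R.linkVec (D.edgeAt c (D.underStrand c) (D.leftHalf c)))) =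
      toPoint (R.linkVec (D.edgeAt c (D.underStrand c) (D.rightHalf c))) := by
  have hne := under_sub_ne_zero hw hm hnd c
  have ho := holonomy_over_regionVec (R := R) hw hm hnd c .out
  have hi := holonomy_over_regionVec (R := R) hw hm hnd c .inc
  apply conj_of_edges hw hm
  · rw [component_edgeAt, component_edgeAt]
  · rw [component_edgeAt, ← region_cornerAt, ← region_cornerAt]
    exact hne _
  · rw [component_edgeAt, ← region_cornerAt, ← region_cornerAt]
    exact hne _
  · rw [← region_cornerAt, ← region_cornerAt]
    cases hc : D.positive c <;>
      simp only [overStrand, underStrand, hc, Strand.other, leftHalf, rightHalf, cornerAt,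
        Bool.false_eq_true, if_false, if_true] at ho hi ⊢ <;> assumption
  · rw [← region_cornerAt, ← region_cornerAt]
    cases hc : D.positive c <;>
      simp only [overStrand, underStrand, hc, Strand.other, leftHalf, rightHalf, cornerAt,
        Bool.false_eq_true, if_false, if_true] at ho hi ⊢ <;> assumption

theorem lift_holonomy_rel (hw : ∀ r, w r ≠ 0) (hm : ∀ i, m i ≠ 0) (hnd : D.IsNondegenerate w m)
    (r : FreeGroup D.Edge) (hr : r ∈ {r | D.WirtingerRel r}) :
    FreeGroup.lift (R.holonomy hm) r = 1 := by
  obtain ⟨c⟩ | ⟨c, hc⟩ | ⟨c, hc⟩ := hr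
  · simp [holonomy_over hw hm hnd]
  · have h := (conj_under (R := R) hw hm hnd c).1
    simp only [leftHalf, rightHalf, hc, if_true, edgeAt] at h
    simp only [map_mul, map_inv, FreeGroup.lift_apply_of]
    rw [mul_assoc _ _ (R.holonomy hm (c, D.overStrand c)), ← h, inv_mul_cancel_left,
      mul_inv_cancel]
  · have h := (conj_under (R := R) hw hm hnd c).1
    simp only [leftHalf, rightHalf, hc, if_false, edgeAt, Bool.false_eq_true] at h
    simp only [map_mul, map_inv, FreeGroup.lift_apply_of]
    rw [h, mul_inv_cancel_right, mul_inv_cancel]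

/-- The holonomy representation, lifted to `SL(2, ℂ)`. -/
noncomputable def rep (R : Coloring D w m) (hw : ∀ r, w r ≠ 0) (hm : ∀ i, m i ≠ 0)
    (hnd : D.IsNondegenerate w m) : D.LinkGroup →* Matrix.SpecialLinearGroup (Fin 2) ℂ :=
  PresentedGroup.toGroup (lift_holonomy_rel (R := R) hw hm hnd)

theorem rep_wirtinger (hw : ∀ r, w r ≠ 0) (hm : ∀ i, m i ≠ 0) (hnd : D.IsNondegenerate w m)
    (e : D.Edge) : R.rep hw hm hnd (D.wirtinger e) = R.holonomy hm e :=
  PresentedGroup.toGroup.of _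

/-! ## The developing map -/

/-- Representatives of the images of the vertices of the reference lift of the octahedron at a
crossing. -/
noncomputable def octVec (R : Coloring D w m) (c : D.Crossing) : OctVertex → Fin 2 → ℂ
  | .top => R.linkVec (c, D.overStrand c)
  | .bottom => R.linkVec (D.edgeAt c (D.underStrand c) (D.leftHalf c))
  | .equator s h =>
    if s = D.overStrand c then R.regionVec (D.region c (cornerAt (D.overStrand c) h .left))
    else if h = D.leftHalf c then ![1, 0]
    else ![m (D.component (c, D.overStrand c)) - R.scale c * R.linkPos (c, D.overStrand c),
      -R.scale c]

theorem linkVec_ne_zero (e : D.Edge) : R.linkVec e ≠ 0 := ne_zero_of_snd (by simp [linkVec])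

theorem regionVec_ne_zero (hw : ∀ r, w r ≠ 0) (r : D.Region) : R.regionVec r ≠ 0 :=
  ne_zero_of_snd (by simp [regionVec, hw])

theorem octVec_ne_zero (hw : ∀ r, w r ≠ 0) (c : D.Crossing) (v : OctVertex) :
    R.octVec c v ≠ 0 := by
  cases v with
  | top => exact linkVec_ne_zero _
  | bottom => exact linkVec_ne_zero _
  | equator s h =>
    simp only [octVec]
    split_ifs
    · exact regionVec_ne_zero hw _
    · exact vec_one_zero_ne
    · exact ne_zero_of_snd (by simp [R.scale_ne_zero])

/-- The under-strand has a vertex at `p` on each side of the over-strand. In the reference lift the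
left one is ∞, and the right one is this preimage of ∞ under the over-strand holonomy. -/
theorem holonomy_opposite (hm : ∀ i, m i ≠ 0) (c : D.Crossing) :
    (R.holonomy hm (c, D.overStrand c)).1.mulVec
      ![m (D.component (c, D.overStrand c)) - R.scale c * R.linkPos (c, D.overStrand c),
        -R.scale c] = ![1, 0] := by
  have h := R.entry_over c .out
  have h3 := hm (D.component (c, D.overStrand c))
  simp only [edgeAt] at h
  ext i
  fin_cases i
  · simp [holonomy, eigenMatrix, Matrix.mulVec, dotProduct, Fin.sum_univ_two, h]
    field_simp
    ring
  · simp [holonomy, eigenMatrix, Matrix.mulVec, dotProduct, Fin.sum_univ_two, h]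
    ring

/-- The developed face in a region along an edge. -/
noncomputable def facePoint (R : Coloring D w m) (e : D.Edge) (r : D.Region) :
    Fin 3 → ℙ ℂ (Fin 2 → ℂ) :=
  ![toPoint (R.linkVec e), toPoint ![1, 0], toPoint (R.regionVec r)]

/-- This is why neighbouring octahedra fit: a face reached by going down in a region depends only on
the edge and the region, not on the crossing. On the right of the over-strand the shift by its
holonomy moves the reference lift into this normal form. -/
theorem rep_shift_smul_octVec (hw : ∀ r, w r ≠ 0) (hm : ∀ i, m i ≠ 0)
    (hnd : D.IsNondegenerate w m) (c : D.Crossing) (s : Strand) (h : Half) (d : Side)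
    (a : Fin 3) :
    (R.rep hw hm hnd (D.cornerShift c (cornerAt s h d)) :
        Matrix.ProjectiveSpecialLinearGroup (Fin 2) ℂ) •
      toPoint (R.octVec c (D.faceVertex c s h d a)) =
    R.facePoint (D.edgeAt c s h) (D.region c (cornerAt s h d)) a := by
  rw [smul_toPoint _ (octVec_ne_zero hw c _)]
  have ho := holonomy_over_regionVec (R := R) hw hm hnd c .out
  have hi := holonomy_over_regionVec (R := R) hw hm hnd c .inc
  have hu := (conj_under (R := R) hw hm hnd c).2
  have hp := holonomy_opposite (R := R) hm c
  have hv : toPoint ((R.holonomy hm (c, D.overStrand c)).1.mulVec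
      (R.linkVec (c, D.overStrand c))) = toPoint (R.linkVec (c, D.overStrand c)) := by
    rw [holonomy_linkVec, toPoint_smul (hm _)]
  have hin : R.linkVec (D.inEdge c (D.overStrand c)) = R.linkVec (c, D.overStrand c) := by
    rw [linkVec, linkVec, linkPos_over hw hm hnd]
  cases hc : D.positive c
  · have hos : D.overStrand c = .alpha := by simp [overStrand, hc]
    simp only [underStrand, hos, Strand.other, leftHalf, rightHalf, hc, Bool.false_eq_true,
      if_false, cornerAt, edgeAt] at ho hi hu hp hv hin
    cases s <;> cases h <;> cases d <;> fin_cases a <;>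
      simp [cornerShift, rep_wirtinger, octVec, faceVertex, facePoint, hos, underStrand,
        Strand.other, otherHalf, leftHalf, hc, cornerAt, edgeAt, ho, hi, hu, hp, hv, hin,
        -Matrix.mulVec_fin_two]
  · have hos : D.overStrand c = .beta := by simp [overStrand, hc]
    simp only [underStrand, hos, Strand.other, leftHalf, rightHalf, hc,
      if_true, cornerAt, edgeAt] at ho hi hu hp hv hin
    cases s <;> cases h <;> cases d <;> fin_cases a <;>
      simp [cornerShift, rep_wirtinger, octVec, faceVertex, facePoint, hos, underStrand,
        Strand.other, otherHalf, leftHalf, hc, cornerAt, edgeAt, ho, hi, hu, hp, hv, hin,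
        -Matrix.mulVec_fin_two]

/-- The developing map. -/
noncomputable def dev (R : Coloring D w m) (hw : ∀ r, w r ≠ 0) (hm : ∀ i, m i ≠ 0)
    (hnd : D.IsNondegenerate w m) (h : D.LinkGroup) (c : D.Crossing) (v : OctVertex) :
    ℙ ℂ (Fin 2 → ℂ) :=
  (R.rep hw hm hnd h : Matrix.ProjectiveSpecialLinearGroup (Fin 2) ℂ) • toPoint (R.octVec c v)

theorem wedge_regionVec_infinity (r : D.Region) : wedge (R.regionVec r) ![1, 0] = -w r := by
  simp [wedge, regionVec]

theorem wedge_regionVec_opposite (hw : ∀ r, w r ≠ 0) (hm : ∀ i, m i ≠ 0)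
    (hnd : D.IsNondegenerate w m) (c : D.Crossing) (h : Half) :
    wedge (R.regionVec (D.region c (cornerAt (D.overStrand c) h .left)))
      ![m (D.component (c, D.overStrand c)) - R.scale c * R.linkPos (c, D.overStrand c),
        -R.scale c] = -w (D.region c (cornerAt (D.overStrand c) h .right)) := by
  rw [← wedge_mulVec (R.holonomy hm (c, D.overStrand c)), holonomy_opposite,
    holonomy_over_regionVec hw hm hnd, wedge_regionVec_infinity]

theorem wedge_linkVec_opposite (e : D.Edge) (a b : ℂ) :
    wedge (R.linkVec e) ![a - b * R.linkPos e, -b] = -a := by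
  simp [wedge, linkVec]
  ring

theorem wedge_linkVec_infinity (e : D.Edge) : wedge (R.linkVec e) ![1, 0] = -1 := by
  simp [wedge, linkVec]

theorem wedge_under_left (hw : ∀ r, w r ≠ 0) (c : D.Crossing) (s : Strand) (h : Half) :
    wedge (R.linkVec (D.edgeAt c s h)) (R.regionVec (D.region c (cornerAt s h .left))) =
      R.edgeScale (D.edgeAt c s h) := by
  rw [region_cornerAt, wedge_linkVec_left hw]

theorem wedge_under_right (hw : ∀ r, w r ≠ 0) (hm : ∀ i, m i ≠ 0) (c : D.Crossing) (s : Strand)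
    (h : Half) :
    wedge (R.linkVec (D.edgeAt c s h)) (R.regionVec (D.region c (cornerAt s h .right))) =
      R.edgeScale (D.edgeAt c s h) / m (D.component (c, s)) := by
  rw [region_cornerAt, wedge_linkVec_right hw hm, component_edgeAt]

/-- Every determinant involved is a region variable, a component variable, an edge scale or a simple
quotient, up to sign; the edge scales cancel in the cross-ratio. -/
theorem crossRatio_octVec (hw : ∀ r, w r ≠ 0) (hm : ∀ i, m i ≠ 0)
    (hnd : D.IsNondegenerate w m) (c : D.Crossing) (t : Fin 5) :
    crossRatio (fun a => toPoint (R.octVec c (D.tetVertex c t a))) = D.shape w m c t := by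
  rw [crossRatio_toPoint fun a => octVec_ne_zero hw c _]
  have f1 := fun r => wedge_regionVec_infinity (R := R) r
  have f2 := fun r => (wedge_swap _ _).trans (neg_eq_iff_eq_neg.mpr (f1 r))
  have f3o := wedge_regionVec_opposite (R := R) hw hm hnd c .out
  have f3i := wedge_regionVec_opposite (R := R) hw hm hnd c .inc
  have f4o := (wedge_swap _ _).trans (neg_eq_iff_eq_neg.mpr f3o)
  have f4i := (wedge_swap _ _).trans (neg_eq_iff_eq_neg.mpr f3i)
  have f5 := wedge_linkVec_opposite (R := R) (c, D.overStrand c)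
    (m (D.component (c, D.overStrand c))) (R.scale c)
  have f6 := fun e => wedge_linkVec_infinity (R := R) e
  have f7 := wedge_under_left (R := R) hw c (D.underStrand c) (D.leftHalf c)
  have f8 := wedge_under_right (R := R) hw hm c (D.underStrand c) (D.leftHalf c)
  have hκ := R.edgeScale_ne_zero (D.edgeAt c (D.underStrand c) (D.leftHalf c))
  have hj := hw (D.region c .j)
  have hk := hw (D.region c .k)
  have hl := hw (D.region c .l)
  have hm' := hw (D.region c .m)
  have ha := hm (D.component (c, .alpha))
  have hb := hm (D.component (c, .beta))
  cases hc : D.positive c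
  · have ho : D.overStrand c = .alpha := by simp [overStrand, hc]
    have hlh : D.leftHalf c = .inc := by simp [leftHalf, hc]
    simp only [underStrand, ho, hlh, Strand.other, cornerAt] at f3o f3i f4o f4i f5 f7 f8 hκ
    fin_cases t <;>
      simp only [tetVertex, shape, octVec, hc, ho, hlh, underStrand, Strand.other, cornerAt,
        Matrix.cons_val, Bool.false_eq_true, if_false, if_true, reduceCtorEq, f1, f2, f3o, f3i,
        f4o, f4i, f5, f6, f7, f8, Fin.zero_eta, Fin.mk_one, Fin.reduceFinMk] <;>
      field_simp
  · have ho : D.overStrand c = .beta := by simp [overStrand, hc]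
    have hlh : D.leftHalf c = .out := by simp [leftHalf, hc]
    simp only [underStrand, ho, hlh, Strand.other, cornerAt] at f3o f3i f4o f4i f5 f7 f8 hκ
    fin_cases t <;>
      simp only [tetVertex, shape, octVec, hc, ho, hlh, underStrand, Strand.other, cornerAt,
        Matrix.cons_val, if_false, if_true, reduceCtorEq, f1, f2, f3o, f3i,
        f4o, f4i, f5, f6, f7, f8, Fin.zero_eta, Fin.mk_one, Fin.reduceFinMk] <;>
      field_simp

theorem isDeveloping_dev (R : Coloring D w m) (hw : ∀ r, w r ≠ 0) (hm : ∀ i, m i ≠ 0)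
    (hnd : D.IsNondegenerate w m) :
    D.IsDeveloping w m ((QuotientGroup.mk' _).comp (R.rep hw hm hnd)) (R.dev hw hm hnd) := by
  have hcr : ∀ h c t, crossRatio (fun a => R.dev hw hm hnd h c (D.tetVertex c t a)) =
      D.shape w m c t := fun h c t => by
    simp only [dev]
    rw [crossRatio_smul _ fun a => toPoint (R.octVec c (D.tetVertex c t a)),
      crossRatio_octVec hw hm hnd]
  refine ⟨fun g h c v => ?_, fun h e d a => ?_, fun h c t => ?_, hcr⟩
  · simp only [dev, map_mul, QuotientGroup.mk_mul, mul_smul]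
    rfl
  · simp only [dev, map_mul, QuotientGroup.mk_mul, mul_smul]
    rw [rep_shift_smul_octVec, rep_shift_smul_octVec]
    simp only [edgeAt, inEdge_next, region_cornerAt_next]
    rfl
  · have := shape_ne hw hm hnd c t
    rw [← hcr h c t] at this
    exact injective_of_crossRatio this.1 this.2

end Coloring

end OrientedDiagram

namespace OrientedDiagram

variable {D : OrientedDiagram}

/-! ## Rigidity of developing maps -/

/-- Each face of the octahedron is a face of one of the tetrahedra, and the central tetrahedron
shares a face with each of the other four. -/
theorem of_tetVertex_closed {c : D.Crossing} {S : OctVertex → Prop}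
    (hS : ∀ t i, (∀ j, j ≠ i → S (D.tetVertex c t j)) → S (D.tetVertex c t i))
    (h : (∃ t, ∀ j, S (D.tetVertex c t j)) ∨ ∃ s h d, ∀ a, S (D.faceVertex c s h d a))
    (v : OctVertex) : S v := by
  have huniv : (∀ v, S v) ↔ S .top ∧ S .bottom ∧ S (.equator .alpha .out) ∧
      S (.equator .alpha .inc) ∧ S (.equator .beta .out) ∧ S (.equator .beta .inc) := by
    refine ⟨fun h => ⟨h _, h _, h _, h _, h _, h _⟩, ?_⟩
    rintro ⟨h1, h2, h3, h4, h5, h6⟩ (_ | _ | ⟨_ | _, _ | _⟩) <;> assumption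
  revert v
  rw [huniv]
  simp only [Fin.forall_fin_succ, IsEmpty.forall_iff, Fin.succ_zero_eq_one, Fin.succ_one_eq_two,
    Fin.reduceSucc, ne_eq, Fin.reduceEq, not_true, not_false_iff, forall_const, and_true,
    true_and] at hS h
  cases hc : D.positive c
  · have ho : D.overStrand c = .alpha := by simp [overStrand, hc]
    simp only [tetVertex, underStrand, ho, hc, Strand.other, if_false, Bool.false_eq_true,
      Matrix.cons_val] at hS
    obtain ⟨t, h⟩ | ⟨s, e, d, h⟩ := h
    · fin_cases t <;>
        simp only [tetVertex, underStrand, ho, hc, Strand.other, if_false,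
          Bool.false_eq_true, Fin.zero_eta, Fin.mk_one, Fin.reduceFinMk, Matrix.cons_val] at h <;>
        grind
    · cases s <;> cases e <;> cases d <;>
        simp only [faceVertex, ho, Strand.other, otherHalf, if_true, if_false, reduceCtorEq,
          Matrix.cons_val] at h <;>
        grind
  · have ho : D.overStrand c = .beta := by simp [overStrand, hc]
    simp only [tetVertex, underStrand, ho, hc, Strand.other, if_true,
      Matrix.cons_val] at hS
    obtain ⟨t, h⟩ | ⟨s, e, d, h⟩ := h
    · fin_cases t <;>
        simp only [tetVertex, underStrand, ho, hc, Strand.other, if_true,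
          Fin.zero_eta, Fin.mk_one, Fin.reduceFinMk, Matrix.cons_val] at h <;>
        grind
    · cases s <;> cases e <;> cases d <;>
        simp only [faceVertex, ho, Strand.other, otherHalf, if_true, if_false, reduceCtorEq,
          Matrix.cons_val] at h <;>
        grind

variable (D) in
/-- A property of the vertices of the universal cover which passes from three vertices of a
tetrahedron to the fourth one. -/
structure IsHereditary (P : D.LinkGroup → D.Crossing → OctVertex → Prop) : Prop where
  tet : ∀ h c t i, (∀ j, j ≠ i → P h c (D.tetVertex c t j)) → P h c (D.tetVertex c t i)
  face : ∀ (h : D.LinkGroup) (e : D.Edge) (d : Side) (a : Fin 3),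
    P (h * D.cornerShift e.1 (cornerAt e.2 .out d)) e.1 (D.faceVertex e.1 e.2 .out d a) ↔
      P (h * D.cornerShift (D.next e).1 (cornerAt (D.next e).2 .inc d)) (D.next e).1
        (D.faceVertex (D.next e).1 (D.next e).2 .inc d a)

theorem cornerShift_over_left (c : D.Crossing) (h : Half) :
    D.cornerShift c (cornerAt (D.overStrand c) h .left) = 1 := by
  cases h <;> simp [cornerShift]

theorem cornerShift_over_right (c : D.Crossing) (h : Half) :
    D.cornerShift c (cornerAt (D.overStrand c) h .right) = D.wirtinger (c, D.overStrand c) := by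
  cases hs : D.overStrand c <;> cases h <;> simp [cornerShift, hs, cornerAt]

/-- The two sides of a half of the under-strand lie on the same side of the over-strand. -/
theorem cornerShift_under (c : D.Crossing) (h : Half) :
    D.cornerShift c (cornerAt (D.underStrand c) h .left) =
      D.cornerShift c (cornerAt (D.underStrand c) h .right) := by
  cases hs : D.overStrand c <;> cases h <;>
    simp [cornerShift, underStrand, hs, cornerAt, Strand.other]

theorem eq_over_or_under (c : D.Crossing) (s : Strand) :
    s = D.overStrand c ∨ s = D.underStrand c := by
  cases hs : D.overStrand c <;> cases s <;> simp [underStrand, hs, Strand.other]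

theorem wirtinger_inEdge_over (c : D.Crossing) :
    D.wirtinger (D.inEdge c (D.overStrand c)) = D.wirtinger (c, D.overStrand c) :=
  PresentedGroup.mk_eq_mk_of_mul_inv_mem (WirtingerRel.over c)

theorem wirtinger_inEdge_under_mem {H : Subgroup D.LinkGroup} (c : D.Crossing)
    (ho : D.wirtinger (c, D.overStrand c) ∈ H) :
    D.wirtinger (D.inEdge c (D.underStrand c)) ∈ H ↔ D.wirtinger (c, D.underStrand c) ∈ H := by
  cases hc : D.positive c
  · have := PresentedGroup.mk_eq_mk_of_mul_inv_mem (rels := {r | D.WirtingerRel r})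
      (WirtingerRel.underNegative c hc)
    rw [map_mul, map_mul, map_inv] at this
    change D.wirtinger _ * D.wirtinger _ * (D.wirtinger _)⁻¹ = D.wirtinger _ at this
    rw [← this, H.mul_mem_cancel_right (H.inv_mem ho), H.mul_mem_cancel_left ho]
  · have := PresentedGroup.mk_eq_mk_of_mul_inv_mem (rels := {r | D.WirtingerRel r})
      (WirtingerRel.underPositive c hc)
    rw [map_mul, map_mul, map_inv] at this
    change (D.wirtinger _)⁻¹ * D.wirtinger _ * D.wirtinger _ = D.wirtinger _ at this
    rw [← this, H.mul_mem_cancel_right ho, H.mul_mem_cancel_left (H.inv_mem ho)]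

/-- Given the over-generators, membership of an edge generator is unchanged through every crossing,
and each component contains an over-passing edge. -/
theorem wirtinger_mem_of_over_mem (hou : D.HasOverUnder) {H : Subgroup D.LinkGroup}
    (ho : ∀ c, D.wirtinger (c, D.overStrand c) ∈ H) : H = ⊤ := by
  have key : ∀ e, D.wirtinger e ∈ H ↔ D.wirtinger (D.next e) ∈ H := fun e => by
    obtain ⟨⟨c, s⟩, rfl⟩ := D.next.symm.surjective e
    change D.wirtinger (D.inEdge c s) ∈ H ↔ _
    rw [Equiv.apply_symm_apply]
    obtain rfl | rfl := eq_over_or_under c s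
    · rw [wirtinger_inEdge_over]
    · exact wirtinger_inEdge_under_mem c (ho c)
  rw [eq_top_iff, ← PresentedGroup.closure_range_of, Subgroup.closure_le]
  rintro _ ⟨e, rfl⟩
  obtain ⟨⟨c, hc⟩, -⟩ := hou (D.component e)
  exact (D.iff_of_component_eq key hc).mp (ho c)

namespace IsHereditary

variable {P : D.LinkGroup → D.Crossing → OctVertex → Prop}

theorem iff_next (hP : D.IsHereditary P) (h : D.LinkGroup) (e : D.Edge) (d : Side) :
    (∀ v, P (h * D.cornerShift e.1 (cornerAt e.2 .out d)) e.1 v) ↔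
      ∀ v, P (h * D.cornerShift (D.next e).1 (cornerAt (D.next e).2 .inc d)) (D.next e).1 v :=
  ⟨fun H => of_tetVertex_closed (hP.tet _ _) (.inr ⟨_, _, _, fun a => (hP.face h e d a).mp (H _)⟩),
    fun H => of_tetVertex_closed (hP.tet _ _)
      (.inr ⟨_, _, _, fun a => (hP.face h e d a).mpr (H _)⟩)⟩

/-- The property holds on all octahedra around the lift `h` of a regional edge. -/
def node (hP : D.IsHereditary P) (h : D.LinkGroup) : D.Region → Prop :=
  Quot.lift (fun x => ∀ v, P (h * D.cornerShift x.1 x.2) x.1 v) fun _ _ hab => by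
    obtain ⟨e, d⟩ := hab
    exact propext (hP.iff_next h e d)

theorem node_region (hP : D.IsHereditary P) (h : D.LinkGroup) (c : D.Crossing) (q : Corner) :
    hP.node h (D.region c q) ↔ ∀ v, P (h * D.cornerShift c q) c v := Iff.rfl

/-- At an under-pass both sides see the same lift of the octahedron, so the claim is immediate
there. At an over-pass it passes from one half to the other, since corners on the same side of the
over-strand share a lift. Every component under-passes somewhere. -/
theorem node_left_iff_right (hP : D.IsHereditary P) (hou : D.HasOverUnder) (h : D.LinkGroup)
    (e : D.Edge) :
    hP.node h (D.sideRegion e .left) ↔ hP.node h (D.sideRegion e .right) := by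
  have hu : ∀ c a, hP.node h (D.sideRegion (D.edgeAt c (D.underStrand c) a) .left) ↔
      hP.node h (D.sideRegion (D.edgeAt c (D.underStrand c) a) .right) := fun c a => by
    rw [← region_cornerAt, ← region_cornerAt, node_region, node_region, cornerShift_under]
  have ho : ∀ c d, hP.node h (D.sideRegion (D.edgeAt c (D.overStrand c) .inc) d) ↔
      hP.node h (D.sideRegion (D.edgeAt c (D.overStrand c) .out) d) := fun c d => by
    rw [← region_cornerAt, ← region_cornerAt, node_region, node_region]
    cases d
    · rw [cornerShift_over_left, cornerShift_over_left]
    · rw [cornerShift_over_right, cornerShift_over_right]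
  obtain ⟨-, c, hc⟩ := hou (D.component e)
  refine (D.iff_of_component_eq (p := fun e => hP.node h (D.sideRegion e .left) ↔
    hP.node h (D.sideRegion e .right)) (fun e => ?_) hc).mp (hu c .out)
  obtain ⟨⟨c, s⟩, rfl⟩ := D.next.symm.surjective e
  rw [Equiv.apply_symm_apply]
  obtain rfl | rfl := eq_over_or_under c s
  · exact iff_congr (ho c .left) (ho c .right)
  · exact iff_of_true (hu c .inc) (hu c .out)

theorem node_iff (hP : D.IsHereditary P) (hD : D.IsConnected) (hou : D.HasOverUnder)
    (h : D.LinkGroup) (r r' : D.Region) : hP.node h r ↔ hP.node h r' :=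
  iff_of_eq (eq_of_forall_side hD (hP.node h)
    (fun e => propext (hP.node_left_iff_right hou h e)) r r')

/-- Going down on the right of an over-strand from `h` reaches the lift that is reached on the left
from `h` times its generator. The over-generators generate the group. -/
theorem node_mul_iff (hP : D.IsHereditary P) (hD : D.IsConnected) (hou : D.HasOverUnder)
    (g : D.LinkGroup) : ∀ h r, hP.node (h * g) r ↔ hP.node h r := by
  let H : Subgroup D.LinkGroup :=
    { carrier := {g | ∀ h r, hP.node (h * g) r ↔ hP.node h r}
      mul_mem' := fun {a b} ha hb h r => by rw [← mul_assoc, hb, ha]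
      one_mem' := fun h r => by rw [mul_one]
      inv_mem' := fun {a} ha h r => by rw [← ha, inv_mul_cancel_right] }
  suffices hH : H = ⊤ from (hH ▸ Subgroup.mem_top g : g ∈ H)
  refine wirtinger_mem_of_over_mem hou fun c h r => ?_
  rw [hP.node_iff hD hou _ r (D.region c (cornerAt (D.overStrand c) .out .left)),
    hP.node_iff hD hou _ r (D.region c (cornerAt (D.overStrand c) .out .right)), node_region,
    node_region, cornerShift_over_left, cornerShift_over_right, mul_one]

theorem forall_of_tet (hP : D.IsHereditary P) (hD : D.IsConnected) (hou : D.HasOverUnder)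
    {h₀ : D.LinkGroup} {c₀ : D.Crossing} {t : Fin 5} (h₁ : ∀ j, P h₀ c₀ (D.tetVertex c₀ t j))
    (h : D.LinkGroup) (c : D.Crossing) : ∀ v, P h c v := by
  have key : ∀ h c, hP.node h (D.region c (cornerAt (D.overStrand c) .out .left)) ↔
      ∀ v, P h c v := fun h c => by
    rw [node_region, cornerShift_over_left, mul_one]
  rw [← key, hP.node_iff hD hou _ _ (D.region c₀ (cornerAt (D.overStrand c₀) .out .left)),
    ← hP.node_mul_iff hD hou (h⁻¹ * h₀), mul_inv_cancel_left, key]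
  exact of_tetVertex_closed (hP.tet _ _) (.inl ⟨t, h₁⟩)

end IsHereditary

variable {w : D.Region → ℂ} {m : D.Component → ℂ}

theorem IsDeveloping.isHereditary
    {ρ ρ' : D.LinkGroup →* Matrix.ProjectiveSpecialLinearGroup (Fin 2) ℂ}
    {dev dev' : D.LinkGroup → D.Crossing → OctVertex → ℙ ℂ (Fin 2 → ℂ)}
    (h : D.IsDeveloping w m ρ dev) (h' : D.IsDeveloping w m ρ' dev')
    (C : Matrix.ProjectiveSpecialLinearGroup (Fin 2) ℂ) :
    D.IsHereditary fun g c v => C • dev g c v = dev' g c v where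
  tet g c t i hi := by
    refine congrFun (eq_of_crossRatio (z := fun a => C • dev g c (D.tetVertex c t a))
      (z' := fun a => dev' g c (D.tetVertex c t a)) ?_ ?_ i hi) i
    · exact (MulAction.injective C).comp (h.injective g c t)
    · rw [crossRatio_smul C fun a => dev g c (D.tetVertex c t a), h.crossRatio_eq,
        h'.crossRatio_eq]
  face g e d a := by rw [h.face, h'.face]

theorem IsDeveloping.exists_conj (hD : D.IsConnected) (hou : D.HasOverUnder)
    {ρ ρ' : D.LinkGroup →* Matrix.ProjectiveSpecialLinearGroup (Fin 2) ℂ}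
    {dev dev' : D.LinkGroup → D.Crossing → OctVertex → ℙ ℂ (Fin 2 → ℂ)}
    (h : D.IsDeveloping w m ρ dev) (h' : D.IsDeveloping w m ρ' dev') :
    ∃ C, ∀ g, ρ' g = C * ρ g * C⁻¹ := by
  obtain ⟨c⟩ := hD.1
  have hi := h.injective 1 c 0
  have hi' := h'.injective 1 c 0
  have h01 : (0 : Fin 4) ≠ 1 := by decide
  have h02 : (0 : Fin 4) ≠ 2 := by decide
  have h12 : (1 : Fin 4) ≠ 2 := by decide
  obtain ⟨C, hC0, hC1, hC2⟩ := exists_smul_eq_three (hi.ne h01) (hi.ne h02) (hi.ne h12)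
    (hi'.ne h01) (hi'.ne h02) (hi'.ne h12)
  have hP := h.isHereditary h' C
  have h3 := hP.tet 1 c 0 3 fun j hj => by
    fin_cases j
    exacts [hC0, hC1, hC2, absurd rfl hj]
  have key := hP.forall_of_tet hD hou (h₀ := 1) (c₀ := c) (t := 0) fun j => by
    fin_cases j
    exacts [hC0, hC1, hC2, h3]
  refine ⟨C, fun g => ?_⟩
  -- Once `C` carries one developing map to the other on all lifts, equivariance makes this element
  -- fix the image of a whole octahedron, in particular three distinct points.
  have hfix : ∀ v, ((ρ' g)⁻¹ * (C * ρ g * C⁻¹)) • dev' 1 c v = dev' 1 c v := fun v => by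
    rw [← key, mul_smul, mul_smul, mul_smul, inv_smul_smul, ← h.equivariant, key, mul_one,
      inv_smul_eq_iff, key, ← h'.equivariant, mul_one]
  exact inv_mul_eq_one.mp
    (eq_one_of_fixes_three (hi'.ne h01) (hi'.ne h02) (hi'.ne h12) (hfix _) (hfix _) (hfix _))

end OrientedDiagram

/-! ### Traces of meridians -/

namespace OrientedDiagram

variable {D : OrientedDiagram} {w : D.Region → ℂ} {m : D.Component → ℂ}

namespace Coloring

/-- The trace in `SL(2, ℂ)` is invariant under conjugation and inversion, so neither the path nor
the orientation matters. -/
theorem trace_rep_meridian (R : Coloring D w m) (hw : ∀ r, w r ≠ 0) (hm : ∀ i, m i ≠ 0)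
    (hnd : D.IsNondegenerate w m) {i : D.Component} {μ : D.LinkGroup} (hμ : D.IsMeridian i μ) :
    (R.rep hw hm hnd μ).1.trace = m i + (m i)⁻¹ := by
  have hconj : ∀ A B : Matrix.SpecialLinearGroup (Fin 2) ℂ,
      (A * B * A⁻¹).1.trace = B.1.trace := fun A B => by
    rw [Matrix.SpecialLinearGroup.coe_mul, Matrix.trace_mul_comm,
      ← Matrix.SpecialLinearGroup.coe_mul, inv_mul_cancel_left]
  obtain ⟨e, h, rfl, rfl | rfl⟩ := hμ
  · rw [map_mul, map_mul, map_inv, hconj, rep_wirtinger, trace_holonomy]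
  · rw [map_mul, map_mul, map_inv, map_inv, hconj, rep_wirtinger, ← trace_holonomy (R := R) hm,
      Matrix.SpecialLinearGroup.coe_inv, Matrix.adjugate_fin_two, Matrix.trace_fin_two,
      Matrix.trace_fin_two]
    exact add_comm _ _

end Coloring

end OrientedDiagram

end LinkPotential

theorem theorem1p1 (D : LinkPotential.OrientedDiagram)
    (hconn : D.IsConnected) (hsph : D.IsSpherical) (hou : D.HasOverUnder)
    (w : D.Region → ℂ) (m : D.Component → ℂ)
    (hw : ∀ r, w r ≠ 0) (hm : ∀ i, m i ≠ 0)
    (hnd : D.IsNondegenerate w m) (hsol : D.IsSolution w m) :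
    (∀ c t, D.shape w m c t ≠ 0 ∧ D.shape w m c t ≠ 1) ∧
    D.GluingEquations w m ∧
    ∃ ρ : D.LinkGroup →* Matrix.ProjectiveSpecialLinearGroup (Fin 2) ℂ,
      D.IsHolonomy w m ρ ∧
      (∀ ρ' : D.LinkGroup →* Matrix.ProjectiveSpecialLinearGroup (Fin 2) ℂ,
        D.IsHolonomy w m ρ' → ∃ C, ∀ g, ρ' g = C * ρ g * C⁻¹) ∧
      ∀ (i : D.Component) (μ : D.LinkGroup), D.IsMeridian i μ →
        ∀ A : Matrix.SpecialLinearGroup (Fin 2) ℂ,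
          (A : Matrix.ProjectiveSpecialLinearGroup (Fin 2) ℂ) = ρ μ →
          ∃ ε : ℂ, (ε = 1 ∨ ε = -1) ∧ A.1.charpoly.roots = {ε * m i, ε * (m i)⁻¹} := by
  refine ⟨LinkPotential.OrientedDiagram.shape_ne hw hm hnd,
    LinkPotential.OrientedDiagram.gluingEquations hw hm hnd hsol, ?_⟩
  obtain ⟨R⟩ := LinkPotential.OrientedDiagram.exists_coloring hconn hsph hw hm hnd hsol
  have hdev := R.isDeveloping_dev hw hm hnd
  refine ⟨_, ⟨_, hdev⟩, fun ρ' ⟨dev', hdev'⟩ => hdev.exists_conj hconn hou hdev',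
    fun i μ hμ A hA => ?_⟩
  -- The representation lifts to `SL(2, ℂ)`, and `A` differs from the lifted meridian by the common
  -- sign `ε`.
  obtain ⟨ε, hε, h⟩ := LinkPotential.coe_eq_coe_psl hA
  refine ⟨ε, hε, LinkPotential.roots_charpoly_of_trace A ?_ ?_⟩
  · rw [mul_mul_mul_comm, mul_inv_cancel₀ (hm i), mul_one]
    obtain rfl | rfl := hε <;> norm_num
  · rw [h, Matrix.trace_smul, R.trace_rep_meridian hw hm hnd hμ, smul_eq_mul, mul_add]
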